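/- **Setting.** For a partition $\mu=(\mu_1\ge\mu_2\ge\dots)$ let $l(\mu)$ be its number of parts, $|\mathrm{Aut}\,\mu|=\prod_i m_i!$ where $m_i$ is the number of parts equal to $i$, and $2\mu=(2\mu_1,2\mu_2,\dots)$. For partitions $\lambda,\mu$ of $d$ let $\chi^\lambda_\mu$ be the value of the irreducible character of $S_d$ attached to $\lambda$ at permutations of cycle type $\mu$, and let $$p_k(\lambda)=\sum_{i\ge1}\Big(\big(\lambda_i-i+\tfrac12\big)^k-\big(-i+\tfrac12\big)^k\Big).$$ For partitions $\alpha,\beta$ of $d\ge 1$ and $g\ge0$, $r\ge1$, $s\ge0$ with $rs=2g-2+l(\alpha)+l(\beta)$, the double Hurwitz number with completed $(r+1)$-cycles is $$H^{g,(r)}_{\alpha,\beta}=\frac{1}{\prod_i\alpha_i\prod_j\beta_j}\sum_{\lambda\vdash d}\chi^\lambda_\alpha\Big(\frac{p_{r+1}(\lambda)}{(r+1)!}\Big)^s\chi^\lambda_\beta .$$ **Statement.** Let $g\ge0$, let $n\ge1$ be odd, and put $s=g+\frac{n-1}{2}$. There is a unique polynomial in $\mathbb{Q}[\beta_1,\dots,\beta_n]$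 whose value at every vector $(\beta_1,\dots,\beta_n)$ of positive integers is $d\,H^{g,(2)}_{(d),\beta}/s!$, where $d=\beta_1+\dots+\beta_n$ and, on the Hurwitz side, $\beta$ stands for the partition of $d$ with parts $\beta_1,\dots,\beta_n$. For integers $b_1,\dots,b_n\ge0$ with $b_1+\dots+b_n=3g+\frac{n-1}{2}$, let the top-degree combinatorial Hodge integral $\langle\langle\tau_{b_1}\cdots\tau_{b_n}\rangle\rangle_g$ be the coefficient of $\beta_1^{b_1}\cdots\beta_n^{b_n}$ in this polynomial. Then $$\langle\langle\tau_{b_1}\cdots\tau_{b_n}\rangle\rangle_g=\frac{1}{2^{3g+\frac{n-1}{2}}}\sum_{h=0}^{g}\frac{(2s-2h)!}{h!\,(s-h)!\,3^h}\sum_{\lambda\vdash g-h}\ \sum_{\vec a\in D_{2g-2h}(\vec b)}\frac{\xi_{2\lambda}\,R_{2\lambda,P_{\vec a}}}{|\mathrm{Aut}\,\lambda|}\binom{g+\frac{n-1}{2}+2h}{b_1-a_1,\dots,b_n-a_n}.$$ Here: - $\xi_{2j}=[x^{2j}]\log(\sinh x/x)$ for $j\geq 1$, and $\xi_{2\lambda}=\xi_{2\lambda_1}\xi_{2\lambda_2}\cdots$;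 - $D_{2j}(\vec b)$ is the set of vectors $(a_1,\dots,a_n)$ of even non-negative integers with $a_i\le b_i$ and $a_1+\dots+a_n=2j$; - $P_{\vec a}$ is the partition whose parts are the nonzero components of $\vec a$; - $R_{\lambda\mu}$ are the coefficients in the expansion $\prod_i\big(\sum_k x_k^{\lambda_i}\big)=\sum_{\mu\vdash|\lambda|}R_{\lambda\mu}\,m_\mu$ of power sums in monomial symmetric functions $m_\mu$; equivalently, $R_{\lambda\mu}$ is the number of ordered set partitions $(A_1,\dots,A_{l(\mu)})$ of $\{1,\dots,l(\lambda)\}$ with $\mu_j=\sum_{i\in A_j}\lambda_i$ for all $j$. -/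

import Mathlib

open scoped Nat

noncomputable section

namespace HurwitzHodge

/-! ### Partitions -/

/-- The parts `μ₁ ≥ μ₂ ≥ … ≥ μ_l` of a partition, as a list. -/
def partList {d : ℕ} (μ : Nat.Partition d) : List ℕ := μ.parts.sort (· ≥ ·)

/-- The length `l(μ)`. -/
def len {d : ℕ} (μ : Nat.Partition d) : ℕ := Multiset.card μ.parts

/-- `|Aut μ| = m₁! m₂! ⋯`, where `mᵢ` is the number of parts equal to `i`. -/
def autCard {d : ℕ} (μ : Nat.Partition d) : ℕ :=
  ∏ i ∈ μ.parts.toFinset, (μ.parts.count i)!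

/-- The partition `2μ = (2μ₁, 2μ₂, …)`. -/
def double {d : ℕ} (μ : Nat.Partition d) : Nat.Partition (2 * d) where
  parts := μ.parts.map (2 * ·)
  parts_pos := by
    intro i hi
    obtain ⟨j, hj, rfl⟩ := Multiset.mem_map.1 hi
    have := μ.parts_pos hj
    omega
  parts_sum := by rw [Multiset.sum_map_mul_left, Multiset.map_id', μ.parts_sum]

/-- The partition obtained by rearranging the components of a vector (zero components, which
are not parts of a partition, are dropped). -/
def ofVec {n : ℕ} (a : Fin n → ℕ) : Nat.Partition (∑ i, a i) :=
  Nat.Partition.ofSums _ (Finset.univ.val.map a) rfl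

/-! ### Irreducible characters of the symmetric group -/

theorem partList_sorted {d : ℕ} (μ : Nat.Partition d) : (partList μ).SortedGE :=
  (Multiset.pairwise_sort _ _).sortedGE

theorem partList_coe {d : ℕ} (μ : Nat.Partition d) : (partList μ : Multiset ℕ) = μ.parts :=
  Multiset.sort_eq _ _

/-- The Young diagram with row lengths `μ₁ ≥ μ₂ ≥ …`. -/
def diagram {d : ℕ} (μ : Nat.Partition d) : YoungDiagram :=
  YoungDiagram.ofRowLens (partList μ) (partList_sorted μ)

theorem card_cellsOfRowLens (w : List ℕ) : (YoungDiagram.cellsOfRowLens w).card = w.sum := by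
  induction w with
  | nil => rfl
  | cons a w ih =>
    rw [YoungDiagram.cellsOfRowLens, Finset.card_union_of_disjoint, Finset.card_map, ih]
    · simp
    · rw [Finset.disjoint_left]
      rintro ⟨i, j⟩ h1 h2
      simp only [Finset.mem_product, Finset.mem_singleton, Finset.mem_map] at h1 h2
      obtain ⟨⟨c1, c2⟩, -, hc⟩ := h2
      have := congrArg Prod.fst hc
      simp at this
      omega

theorem card_diagram {d : ℕ} (μ : Nat.Partition d) :
    Fintype.card {c // c ∈ (diagram μ).cells} = d := by
  rw [Fintype.card_coe]
  change (YoungDiagram.cellsOfRowLens (partList μ)).card = d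
  rw [card_cellsOfRowLens, ← Multiset.sum_coe, partList_coe, μ.parts_sum]

/-- A fixed tableau of shape `μ`: a numbering of the cells of the diagram by `Fin d`. (The
isomorphism class of the representation below does not depend on the numbering.) -/
def tableau {d : ℕ} (μ : Nat.Partition d) : Fin d ≃ {c // c ∈ (diagram μ).cells} :=
  (Fintype.equivFinOfCardEq (card_diagram μ)).symm

/-- Permutations that preserve every row of the tableau. -/
def rowPerms {d : ℕ} (μ : Nat.Partition d) : Finset (Equiv.Perm (Fin d)) :=
  {σ | ∀ i, (tableau μ (σ i)).1.1 = (tableau μ i).1.1}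

/-- Permutations that preserve every column of the tableau. -/
def colPerms {d : ℕ} (μ : Nat.Partition d) : Finset (Equiv.Perm (Fin d)) :=
  {σ | ∀ i, (tableau μ (σ i)).1.2 = (tableau μ i).1.2}

/-- The Young symmetrizer `c_μ = (∑_{p} p) (∑_{q} sgn(q) q)`, with `p` running over the row
group and `q` over the column group. -/
def youngSymmetrizer {d : ℕ} (μ : Nat.Partition d) : MonoidAlgebra ℚ (Equiv.Perm (Fin d)) :=
  (∑ p ∈ rowPerms μ, MonoidAlgebra.of ℚ _ p) *
    ∑ q ∈ colPerms μ, ((Equiv.Perm.sign q : ℤ) : ℚ) • MonoidAlgebra.of ℚ _ q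

/-- The underlying space of the irreducible representation attached to `μ`: the left ideal
`ℚ[S_d] c_μ`. -/
abbrev spechtIdeal {d : ℕ} (μ : Nat.Partition d) :
    Ideal (MonoidAlgebra ℚ (Equiv.Perm (Fin d))) :=
  Ideal.span {youngSymmetrizer μ}

/-- The irreducible representation of `S_d` attached to `μ`: left multiplication on
`ℚ[S_d] c_μ`. -/
def spechtRep {d : ℕ} (μ : Nat.Partition d) :
    Representation ℚ (Equiv.Perm (Fin d)) (spechtIdeal μ) :=
  Representation.ofModule' (spechtIdeal μ)

theorem exists_perm_parts {d : ℕ} (μ : Nat.Partition d) :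
    ∃ σ : Equiv.Perm (Fin d), σ.partition.parts = μ.parts := by
  have hsplit := Multiset.filter_add_not (fun i => 2 ≤ i) μ.parts
  have hones : μ.parts.filter (fun i => ¬ 2 ≤ i) =
      Multiset.replicate (Multiset.card (μ.parts.filter (fun i => ¬ 2 ≤ i))) 1 := by
    rw [Multiset.eq_replicate]
    refine ⟨rfl, fun i hi => ?_⟩
    have h1 := Multiset.mem_filter.1 hi
    have := μ.parts_pos h1.1
    omega
  have hsum := congrArg Multiset.sum hsplit
  rw [Multiset.sum_add, μ.parts_sum, hones, Multiset.sum_replicate, smul_eq_mul, mul_one] at hsum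
  obtain ⟨σ, hσ⟩ := (Equiv.Perm.exists_with_cycleType_iff (Fin d)
    (m := μ.parts.filter (fun i => 2 ≤ i))).2
      ⟨by rw [Fintype.card_fin]; omega, fun a ha => (Multiset.mem_filter.1 ha).2⟩
  refine ⟨σ, ?_⟩
  rw [Equiv.Perm.parts_partition, ← Equiv.Perm.sum_cycleType, hσ, Fintype.card_fin]
  conv_rhs => rw [← hsplit, hones]
  congr 2
  omega

/-- The value `χ^μ_ν` of the irreducible character attached to `μ` at the permutations of cycle
type `ν`. -/
def irrChar {d : ℕ} (μ ν : Nat.Partition d) : ℚ :=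
  (spechtRep μ).character (exists_perm_parts ν).choose

/-- The choice of the permutation in `irrChar` does not matter. -/
theorem irrChar_eq {d : ℕ} (μ ν : Nat.Partition d) (σ : Equiv.Perm (Fin d))
    (hσ : σ.partition.parts = ν.parts) : irrChar μ ν = (spechtRep μ).character σ := by
  have h : IsConj σ (exists_perm_parts ν).choose := by
    rw [Equiv.Perm.partition_eq_of_isConj]
    exact Nat.Partition.ext (hσ.trans (exists_perm_parts ν).choose_spec.symm)
  obtain ⟨c, hc⟩ := isConj_iff.1 h
  rw [irrChar, ← hc, mul_assoc, Representation.char_mul_comm, mul_assoc, inv_mul_cancel, mul_one]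

/-! ### Double Hurwitz numbers with completed cycles -/

/-- The shifted symmetric power sum
`p_k(μ) = ∑_{i ≥ 1} ((μ_i - i + 1/2)^k - (-i + 1/2)^k)`; the terms with `i > l(μ)` vanish, and
the row index `i` below starts from `0`. -/
def shiftedPowerSum (k : ℕ) {d : ℕ} (μ : Nat.Partition d) : ℚ :=
  ∑ i : Fin (partList μ).length,
    ((((partList μ).get i : ℚ) - ((i : ℕ) + 1) + 1 / 2) ^ k - (-((i : ℕ) + 1 : ℚ) + 1 / 2) ^ k)

/-- The disconnected double Hurwitz number with completed `(r+1)`-cycles,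
`H^{g,(r)}_{α,β} = (∏ αᵢ ∏ βⱼ)⁻¹ ∑_{μ ⊢ d} χ^μ_α (p_{r+1}(μ) / (r+1)!)^s χ^μ_β`,
where `r s = 2g - 2 + l(α) + l(β)` (it is considered only if such an `s` exists). -/
def doubleHurwitz (g r : ℕ) {d : ℕ} (α β : Nat.Partition d) : ℚ :=
  1 / ((α.parts.prod : ℚ) * (β.parts.prod : ℚ)) *
    ∑ μ : Nat.Partition d,
      irrChar μ α * (shiftedPowerSum (r + 1) μ / ((r + 1)! : ℚ)) ^ ((2 * g + len α + len β - 2) / r)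
        * irrChar μ β

/-! ### Combinatorial Hodge integrals -/

/-- `P` is the polynomial `d H^{g,(2)}_{(d),β} / s!` in the parts `β₁, …, βₙ`, where
`d = β₁ + ⋯ + βₙ` and `s = g + (n-1)/2`. -/
def IsHurwitzPolynomial (g n : ℕ) (P : MvPolynomial (Fin n) ℚ) : Prop :=
  ∀ β : Fin n → ℕ, (∀ i, 0 < β i) →
    MvPolynomial.eval (fun i => (β i : ℚ)) P =
      ((∑ i, β i : ℕ) : ℚ) *
        doubleHurwitz g 2 (Nat.Partition.indiscrete (∑ i, β i)) (ofVec β) /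
          ((g + (n - 1) / 2)! : ℚ)

open Classical in
/-- The polynomial `d H^{g,(2)}_{(d),β} / s!` in `β₁, …, βₙ` (with the value `0` if there were
none). -/
def hurwitzPolynomial (g n : ℕ) : MvPolynomial (Fin n) ℚ :=
  if h : ∃ P, IsHurwitzPolynomial g n P then h.choose else 0

/-- The combinatorial Hodge integral `⟨⟨τ_{b₁} ⋯ τ_{bₙ} Λ_{2k}⟩⟩_g`, that is
`(-1)^k [β₁^{b₁} ⋯ βₙ^{bₙ}] (d H^{g,(2)}_{(d),β} / s!)`; it vanishes unless
`b₁ + ⋯ + bₙ + 2k = 3g + (n-1)/2`. -/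
def combHodge (g k : ℕ) {n : ℕ} (b : Fin n → ℕ) : ℚ :=
  if ∑ i, b i + 2 * k = 3 * g + (n - 1) / 2 then
    (-1) ^ k * (hurwitzPolynomial g n).coeff (Finsupp.equivFunOnFinite.symm b)
  else 0

/-- The Witten term `⟨⟨τ_{b₁} ⋯ τ_{bₙ}⟩⟩_g = ⟨⟨τ_{b₁} ⋯ τ_{bₙ} Λ₀⟩⟩_g`. -/
def wittenTerm (g : ℕ) {n : ℕ} (b : Fin n → ℕ) : ℚ := combHodge g 0 b

/-! ### The ingredients of the closed formula -/

/-- The power series `sinh x / x`. -/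
def sinhDivX : PowerSeries ℚ :=
  PowerSeries.mk fun m => if Even m then 1 / ((m + 1)! : ℚ) else 0

theorem X_mul_sinhDivX :
    PowerSeries.X * sinhDivX =
      PowerSeries.C (1 / 2 : ℚ) * (PowerSeries.exp ℚ - PowerSeries.evalNegHom (PowerSeries.exp ℚ)) := by
  ext m
  rw [PowerSeries.coeff_C_mul, map_sub, PowerSeries.evalNegHom, PowerSeries.coeff_rescale]
  cases m with
  | zero => simp
  | succ m =>
    rw [mul_comm, PowerSeries.coeff_succ_mul_X, sinhDivX, PowerSeries.coeff_mk,
      PowerSeries.coeff_exp]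
    by_cases hm : Even m
    · rw [if_pos hm, (Even.add_one hm).neg_one_pow]
      simp
      ring
    · rw [if_neg hm, (Nat.not_even_iff_odd.1 hm).add_one.neg_one_pow]
      simp

/-- `ξ_m = [x^m] log (sinh x / x)`. -/
def xi (m : ℕ) : ℚ := PowerSeries.coeff m (PowerSeries.logOf sinhDivX)

/-- `ξ_μ = ξ_{μ₁} ξ_{μ₂} ⋯`. -/
def xiPart {d : ℕ} (μ : Nat.Partition d) : ℚ := (μ.parts.map xi).prod

/-- `R_{λμ}`: the coefficients of the expansion of the power sum `P_λ` in monomial symmetric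
functions (see `psumPart_eq_sum_msymm`). It is the number of ordered set partitions
`(A₁, …, A_{l(μ)})` of `{1, …, l(λ)}` with `μ_j = ∑_{i ∈ A_j} λ_i` for all `j`, the ordered set
partition being given by the map `f` with `A_j = f⁻¹(j)`. -/
def R {k l : ℕ} (lam : Nat.Partition k) (mu : Nat.Partition l) : ℕ :=
  Fintype.card {f : Fin (partList lam).length → Fin (partList mu).length //
    ∀ j, ∑ i with f i = j, (partList lam).get i = (partList mu).get j}

theorem exists_equiv_of_map_eq {α β : Type*} [Fintype α] [Fintype β] (f : α → ℕ) (g : β → ℕ)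
    (h : Finset.univ.val.map f = Finset.univ.val.map g) : ∃ e : α ≃ β, ∀ a, g (e a) = f a := by
  classical
  have hc : ∀ c, Fintype.card {a // f a = c} = Fintype.card {b // g b = c} := by
    intro c
    have := congrArg (Multiset.count c) h
    rw [Multiset.count_map, Multiset.count_map] at this
    rw [Fintype.card_subtype, Fintype.card_subtype]
    simpa [Finset.card, eq_comm] using this
  exact ⟨Equiv.ofFiberEquiv fun c => Fintype.equivOfCardEq (hc c),
    fun a => Equiv.ofFiberEquiv_map _ a⟩

theorem card_maps_eq {σ : Type*} [Fintype σ] [DecidableEq σ] (w v : List ℕ)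
    (hw : ∀ x ∈ w, 0 < x) (s : Multiset σ)
    (hv : s.dedup.map (fun x => s.count x) = (v : Multiset ℕ)) :
    Fintype.card {f : Fin w.length → σ // ∀ x, ∑ i with f i = x, w.get i = s.count x} =
      Fintype.card {f : Fin w.length → Fin v.length //
        ∀ j, ∑ i with f i = j, w.get i = v.get j} := by
  classical
  obtain ⟨e, he⟩ := exists_equiv_of_map_eq v.get (fun x : {x // x ∈ s.toFinset} => s.count x.1) (by
    have h2 : Finset.univ.val.map v.get = (v : Multiset ℕ) := by simp [Fin.univ_def]
    have h5 : (Finset.univ : Finset {x // x ∈ s.toFinset}).val.map (fun x => s.count x.1) =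
        ((Finset.univ : Finset {x // x ∈ s.toFinset}).val.map Subtype.val).map
          (fun x => s.count x) := by
      rw [Multiset.map_map]; rfl
    rw [h2, ← hv, h5]
    congr 1
    exact (Multiset.attach_map_val _).symm)
  symm
  refine Fintype.card_congr (Equiv.ofBijective (fun f => ⟨fun i => (e (f.1 i)).1, ?_⟩) ⟨?_, ?_⟩)
  · intro x
    by_cases hx : x ∈ s.toFinset
    · obtain ⟨j, hj⟩ := e.surjective ⟨x, hx⟩
      have h := f.2 j
      rw [← he j, hj] at h
      rw [← h]
      refine Finset.sum_congr (Finset.filter_congr fun i _ => ?_) fun _ _ => rfl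
      rw [← e.apply_eq_iff_eq, hj, Subtype.ext_iff]
    · rw [Multiset.count_eq_zero_of_notMem (fun h => hx (Multiset.mem_toFinset.2 h))]
      refine Finset.sum_eq_zero fun i hi => ?_
      exact absurd ((Finset.mem_filter.1 hi).2 ▸ (e (f.1 i)).2) hx
  · intro f₁ f₂ h
    ext i
    have := congrFun (congrArg Subtype.val h) i
    rw [e.injective (Subtype.ext this)]
  · intro f
    have hmem : ∀ i, f.1 i ∈ s.toFinset := by
      intro i
      rw [Multiset.mem_toFinset, ← Multiset.count_pos, ← f.2 (f.1 i)]
      exact lt_of_lt_of_le (hw _ (List.get_mem w i))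
        (Finset.single_le_sum (f := w.get) (fun _ _ => Nat.zero_le _)
          (Finset.mem_filter.2 ⟨Finset.mem_univ i, rfl⟩))
    refine ⟨⟨fun i => e.symm ⟨f.1 i, hmem i⟩, fun j => ?_⟩, ?_⟩
    · rw [← he j, ← f.2]
      refine Finset.sum_congr (Finset.filter_congr fun i _ => ?_) fun _ _ => rfl
      rw [Equiv.symm_apply_eq, Subtype.ext_iff]
    · ext i
      simp

theorem partList_pos {d : ℕ} (μ : Nat.Partition d) : ∀ x ∈ partList μ, 0 < x := fun _ hx =>
  μ.parts_pos ((Multiset.mem_sort _).1 hx)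

/-- `P_λ = ∑_{μ ⊢ |λ|} R_{λμ} m_μ`, in any finite set of variables. -/
theorem psumPart_eq_sum_msymm (σ : Type*) [Fintype σ] [DecidableEq σ] {k : ℕ}
    (lam : Nat.Partition k) :
    MvPolynomial.psumPart σ ℚ lam =
      ∑ mu : Nat.Partition k, (R lam mu : ℚ) • MvPolynomial.msymm σ ℚ mu := by
  classical
  set w := partList lam with hwdef
  have hwsum : ∑ i, w.get i = k := by
    rw [← lam.parts_sum, ← partList_coe, Multiset.sum_coe, ← hwdef]
    simp
  let S : (Fin w.length → σ) → Sym σ k := fun f =>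
    ⟨∑ i, Multiset.replicate (w.get i) (f i), by simpa using hwsum⟩
  have hcount : ∀ f x, (S f).1.count x = ∑ i with f i = x, w.get i := by
    intro f x
    simp only [S]
    rw [Multiset.count_sum', Finset.sum_filter]
    simp [Multiset.count_replicate]
  have hL : MvPolynomial.psumPart σ ℚ lam = ∑ f : Fin w.length → σ,
      (((S f).1.map MvPolynomial.X).prod : MvPolynomial σ ℚ) := by
    have h1 : MvPolynomial.psumPart σ ℚ lam = ∏ i : Fin w.length, MvPolynomial.psum σ ℚ (w.get i) := by
      rw [MvPolynomial.psumPart, ← partList_coe, Multiset.map_coe, Multiset.prod_coe, ← hwdef]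
      simp
    rw [h1]
    simp only [MvPolynomial.psum]
    rw [Finset.prod_univ_sum, Fintype.piFinset_univ]
    refine Finset.sum_congr rfl fun f _ => ?_
    simp only [S]
    rw [← Multiset.coe_mapAddMonoidHom, map_sum, Multiset.prod_sum]
    simp
  have hR : ∀ s : Sym σ k, (Finset.univ.filter fun f => S f = s).card =
      R lam (Nat.Partition.ofSym s) := by
    intro s
    rw [R, ← card_maps_eq w _ (partList_pos lam) s.1 (by rw [partList_coe]; rfl),
      Fintype.card_subtype]
    congr 1
    refine Finset.filter_congr fun f _ => ?_
    exact ⟨fun h x => by rw [← hcount, h],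
      fun h => Subtype.ext (Multiset.ext.2 fun x => (hcount f x).trans (h x))⟩
  have h6 : ∀ mu : Nat.Partition k, (R lam mu : ℚ) • MvPolynomial.msymm σ ℚ mu =
      ∑ s : Sym σ k with Nat.Partition.ofSym s = mu,
        (R lam (Nat.Partition.ofSym s) : ℚ) • ((s.1.map MvPolynomial.X).prod : MvPolynomial σ ℚ) := by
    intro mu
    rw [MvPolynomial.msymm, Finset.smul_sum]
    rw [Finset.sum_subtype (p := fun s : Sym σ k => Nat.Partition.ofSym s = mu) _ (by simp)]
    exact Finset.sum_congr rfl fun s _ => by rw [s.2]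
  rw [Finset.sum_congr rfl fun mu _ => h6 mu, Finset.sum_fiberwise, hL,
    ← Finset.sum_fiberwise Finset.univ S]
  refine Finset.sum_congr rfl fun s _ => ?_
  rw [← hR s, Finset.sum_congr rfl (g := fun _ =>
    ((s.1.map MvPolynomial.X).prod : MvPolynomial σ ℚ)) (fun f hf => by
      rw [(Finset.mem_filter.1 hf).2]), Finset.sum_const, Nat.cast_smul_eq_nsmul]

/-- `D_m(b)`: the vectors `a` with even components, `a_i ≤ b_i`, and `a₁ + ⋯ + aₙ = m`. -/
def D (m : ℕ) {n : ℕ} (b : Fin n → ℕ) : Finset (Fin n → ℕ) :=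
  {a ∈ Fintype.piFinset fun i => Finset.range (b i + 1) |
    (∀ i, Even (a i)) ∧ ∑ i, a i = m}

end HurwitzHodge

end

/-! A full cycle sees only hooks: `χ^λ_{(d)}` equals `(-1)^k` on the hook `(d-k, 1^k)` and vanishes
on every other partition. The sum over `λ ⊢ d` therefore becomes a sum over `0 ≤ k < d`. Hook
characters at `β` are governed by the polynomial `Q` with `(1 - X) Q = ∏ (1 - X^{β_i})`: the value
on the hook of leg `k` is `(-1)^k [X^k] Q` (`irrChar_hook`), so the signs cancel in the sum.

Since representations are left ideals of `ℚ[S_d]` here, these facts are derived from Young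
symmetrizers. A symmetrizer of a set times the antisymmetrizer of its complement generates an
exterior power of the permutation module, whose signed characters are the coefficients of `∏ (1 -
X^{β_i})`. An exact sequence (`idealChar_symSum_mul_altSum`) splits such a power into two adjacent
hooks, which accounts for the division by `1 - X`. Non-hooks vanish at a full cycle because the
alternating sum of hook characters is `d` times the indicator of full cycles, and every non-hook is
orthogonal to every hook.

On the hook of leg `k` one has `p_3/3! = d^3/24 + (d/8)(d-1-2k)^2`. Expanding its `s`-th power
leaves the moments `∑ Q_k (d-1-2k)^m`, read off from `∑ Q_k e^{(d-1-2k)x} = 2^{n-1} ∏ sinh(β_i x) /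
sinh x`. This yields an explicit polynomial in `β` (`isHurwitzPolynomial_explicitPolynomial`), which
is unique because positive integer points are dense enough to determine a polynomial.

In top degree the factor `(sinh x / x)⁻¹` contributes only its constant term `1`. The exponential
formula turns `∏ sinh(β_i x)/(β_i x) = exp(∑ ξ_{2j} p_{2j}(β) x^{2j})` into a sum of `ξ_{2λ} P_{2λ}
/ |Aut λ|` (`coeff_sinhProd_eq`). Extracting a monomial gives `R` from `P_{2λ}` and a multinomial
coefficient from the power of `d = ∑ β_i`. -/

noncomputable section

namespace HurwitzHodge

/-! ### Characters of left ideals of a group algebra -/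

section GroupAlgebra

variable {G : Type*} [Group G]

/-- The character of the representation of `G` on a left ideal of `ℚ[G]`. -/
def idealChar (I : Ideal (MonoidAlgebra ℚ G)) (g : G) : ℚ :=
  (Representation.ofModule' (k := ℚ) (G := G) I).character g

theorem ofModule'_apply (M : Type*) [AddCommGroup M] [Module ℚ M] [Module (MonoidAlgebra ℚ G) M]
    [IsScalarTower ℚ (MonoidAlgebra ℚ G) M] (g : G) (x : M) :
    Representation.ofModule' (k := ℚ) (G := G) M g x = MonoidAlgebra.of ℚ G g • x := by
  simp [Representation.ofModule']

theorem idealChar_eq_trace (I : Ideal (MonoidAlgebra ℚ G)) (g : G) :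
    idealChar I g = LinearMap.trace ℚ I (Representation.ofModule' (k := ℚ) (G := G) I g) := rfl

variable [Fintype G]

/-- By Maschke the inclusion of `I` has a linear retraction `f` over the group algebra, and `x =
f(x) = x f(1)` for `x ∈ I`. -/
theorem exists_right_unit (I : Ideal (MonoidAlgebra ℚ G)) : ∃ e ∈ I, ∀ x ∈ I, x * e = x := by
  obtain ⟨f, hf⟩ := MonoidAlgebra.exists_leftInverse_of_injective (k := ℚ) (G := G)
    I.subtype (Submodule.ker_subtype I)
  refine ⟨f 1, (f 1).2, fun x hx => ?_⟩
  have h1 := congrArg Subtype.val (LinearMap.congr_fun hf ⟨x, hx⟩)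
  have h2 : f x = x • f 1 := by rw [← map_smul, smul_eq_mul, mul_one]
  simpa [h2] using h1

theorem idealChar_add_of_exact {M N V : Ideal (MonoidAlgebra ℚ G)}
    (i : N →ₗ[MonoidAlgebra ℚ G] M) (f : M →ₗ[MonoidAlgebra ℚ G] V)
    (hi : Function.Injective i) (hf : Function.Surjective f) (h : Function.Exact i f) (g : G) :
    idealChar M g = idealChar N g + idealChar V g := by
  obtain ⟨l, hl⟩ := MonoidAlgebra.exists_leftInverse_of_injective (k := ℚ) (G := G)
    i (LinearMap.ker_eq_bot.2 hi)
  obtain ⟨e, he, he'⟩ := exists_right_unit V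
  obtain ⟨m, hm⟩ := hf ⟨e, he⟩
  -- Right multiplication by a lift `m` of the right unit `e` of `V` is a section, since `f(x m) = x
  -- e = x`.
  let s₀ : V →ₗ[MonoidAlgebra ℚ G] M :=
    LinearMap.toSpanSingleton (MonoidAlgebra ℚ G) M m ∘ₗ V.subtype
  have hl' : ∀ x, l (i x) = x := fun x => LinearMap.congr_fun hl x
  have hs₀' : ∀ x, f (s₀ x) = x := fun x => by
    simp only [s₀, LinearMap.comp_apply, LinearMap.toSpanSingleton_apply, map_smul, hm]
    exact Subtype.ext (he' x x.2)
  -- Subtracting the component in the image of `i` makes `l ∘ s = 0`, so that `id = i ∘ l + s ∘ f`;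
  -- cyclicity of the trace then separates the two summands.
  let s := s₀ - i ∘ₗ l ∘ₗ s₀
  have hs : ∀ x, f (s x) = x := fun x => by
    simp [s, hs₀', h.apply_apply_eq_zero]
  have hid : ∀ x, x = i (l x) + s (f x) := fun x => by
    obtain ⟨y, hy⟩ := (h (x - s₀ (f x))).1 (by simp [hs₀'])
    have hx : x = i y + s₀ (f x) := by rw [hy]; abel
    conv_rhs => rw [hx]
    simp only [map_add, hl', hs₀', h.apply_apply_eq_zero, s, LinearMap.sub_apply,
      LinearMap.comp_apply, zero_add]
    conv_lhs => rw [hx]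
    abel
  simp only [idealChar_eq_trace]
  have key : Representation.ofModule' (k := ℚ) (G := G) M g =
      (i.restrictScalars ℚ ∘ₗ Representation.ofModule' (k := ℚ) (G := G) N g) ∘ₗ
        l.restrictScalars ℚ +
      (s.restrictScalars ℚ ∘ₗ Representation.ofModule' (k := ℚ) (G := G) V g) ∘ₗ
        f.restrictScalars ℚ := by
    ext1 x
    simp only [ofModule'_apply, LinearMap.add_apply, LinearMap.comp_apply,
      LinearMap.restrictScalars_apply, map_smul, ← smul_add]
    rw [← hid]
  rw [key, map_add]
  have h1 : l.restrictScalars ℚ ∘ₗ (i.restrictScalars ℚ ∘ₗ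
      Representation.ofModule' (k := ℚ) (G := G) N g) = Representation.ofModule' N g :=
    LinearMap.ext fun x => hl' _
  have h2 : f.restrictScalars ℚ ∘ₗ (s.restrictScalars ℚ ∘ₗ
      Representation.ofModule' (k := ℚ) (G := G) V g) = Representation.ofModule' V g :=
    LinearMap.ext fun x => hs _
  rw [LinearMap.trace_comp_comm' (l.restrictScalars ℚ) _,
    LinearMap.trace_comp_comm' (f.restrictScalars ℚ) _, h1, h2]

/-- The pairing of the characters counts intertwiners `T` from `ℚ[G]c` to `ℚ[G]c'`. With `e` a right
unit of the source and `T e = v c'`, one gets `T c = T (c e) = c v c' = 0`, so there are none but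
zero. -/
theorem sum_idealChar_mul_eq_zero (c c' : MonoidAlgebra ℚ G) (h : ∀ x, c * x * c' = 0) :
    ∑ g, idealChar (Ideal.span {c'}) g * idealChar (Ideal.span {c}) g⁻¹ = 0 := by
  have hc : (Nat.card G : ℚ) ≠ 0 := Nat.cast_ne_zero.2 Nat.card_pos.ne'
  have : Invertible (Nat.card G : ℚ) := invertibleOfNonzero hc
  have key := Representation.card_inv_mul_sum_char_mul_char_eq_finrank
    (Representation.ofModule' (k := ℚ) (G := G) (Ideal.span {c} : Ideal (MonoidAlgebra ℚ G)))
    (Representation.ofModule' (k := ℚ) (G := G) (Ideal.span {c'} : Ideal (MonoidAlgebra ℚ G)))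
  have hz : Subsingleton (Representation.IntertwiningMap
      (Representation.ofModule' (k := ℚ) (G := G) (Ideal.span {c} : Ideal (MonoidAlgebra ℚ G)))
      (Representation.ofModule' (k := ℚ) (G := G)
        (Ideal.span {c'} : Ideal (MonoidAlgebra ℚ G)))) := by
    suffices H : ∀ T : Representation.IntertwiningMap
      (Representation.ofModule' (k := ℚ) (G := G) (Ideal.span {c} : Ideal (MonoidAlgebra ℚ G)))
      (Representation.ofModule' (k := ℚ) (G := G)
        (Ideal.span {c'} : Ideal (MonoidAlgebra ℚ G))), ∀ x, T x = 0 from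
      ⟨fun T T' => by 
        refine Representation.IntertwiningMap.ext (LinearMap.ext fun x => ?_)
        exact (H T x).trans (H T' x).symm⟩
    intro T
    have hlin : ∀ (a : MonoidAlgebra ℚ G) x, T (a • x) = a • T x := by
      intro a x
      induction a using MonoidAlgebra.induction_on with
      | of g =>
        exact (congrArg T (ofModule'_apply _ g x)).symm.trans
          ((LinearMap.congr_fun (T.isIntertwining' g) x).trans (ofModule'_apply _ g (T x)))
      | add a b ha hb => rw [add_smul, map_add, ha, hb, add_smul]
      | smul r a ha => rw [smul_assoc, map_smul, ha, smul_assoc]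
    obtain ⟨e, he, he'⟩ := exists_right_unit (Ideal.span {c})
    have hTc : T ⟨c, Ideal.mem_span_singleton_self c⟩ = 0 := by
      have h1 : (⟨c, Ideal.mem_span_singleton_self c⟩ :
          (Ideal.span {c} : Ideal (MonoidAlgebra ℚ G))) = c • ⟨e, he⟩ :=
        Subtype.ext (he' c (Ideal.mem_span_singleton_self c)).symm
      rw [h1, hlin]
      obtain ⟨v, hv⟩ := Ideal.mem_span_singleton'.1 (T ⟨e, he⟩).2
      apply Subtype.ext
      rw [Submodule.coe_smul, smul_eq_mul, ← hv, ← mul_assoc, h]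
      rfl
    rintro ⟨x, hx⟩
    obtain ⟨u, rfl⟩ := Ideal.mem_span_singleton'.1 hx
    have h1 : (⟨u * c, hx⟩ : (Ideal.span {c} : Ideal (MonoidAlgebra ℚ G))) =
      u • ⟨c, Ideal.mem_span_singleton_self c⟩ := rfl
    rw [h1, hlin, hTc, smul_zero]
  rw [Module.finrank_zero_of_subsingleton, Nat.cast_zero] at key
  exact (mul_eq_zero.1 key).resolve_left (inv_ne_zero hc)

/-- Right multiplication by `m⁻¹ c` projects the group algebra onto the ideal. The character is thus
the trace of `x ↦ m⁻¹ g x c` on the whole algebra, computed in the basis of group elements. -/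
theorem idealChar_of_quasi_idempotent [DecidableEq G] (c : MonoidAlgebra ℚ G) (m : ℚ) (hm : m ≠ 0)
    (hc : c * c = m • c) (g : G) :
    idealChar (Ideal.span {c}) g = m⁻¹ * ∑ h, c.coeff (h⁻¹ * g⁻¹ * h) := by
  let I : Ideal (MonoidAlgebra ℚ G) := Ideal.span {c}
  let ι : I →ₗ[ℚ] MonoidAlgebra ℚ G := I.subtype.restrictScalars ℚ
  let π : MonoidAlgebra ℚ G →ₗ[ℚ] I := 
    (LinearMap.mulRight ℚ (m⁻¹ • c)).codRestrict (I.restrictScalars ℚ) (fun x => by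
      simp only [LinearMap.mulRight_apply, mul_smul_comm, Submodule.restrictScalars_mem]
      rw [← smul_mul_assoc]
      exact Ideal.mul_mem_left _ _ (Ideal.mem_span_singleton_self c))
  have hπ : ∀ x : I, π (ι x) = x := by
    rintro ⟨x, hx⟩
    obtain ⟨u, rfl⟩ := Ideal.mem_span_singleton'.1 hx
    apply Subtype.ext
    change u * c * (m⁻¹ • c) = u * c
    rw [mul_smul_comm, mul_assoc, hc, mul_smul_comm, smul_smul, inv_mul_cancel₀ hm, one_smul]
  have h1 : idealChar I g = LinearMap.trace ℚ _
      (ι ∘ₗ (Representation.ofModule' (k := ℚ) (G := G) I g ∘ₗ π)) := by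
    rw [LinearMap.trace_comp_comm', idealChar_eq_trace]
    exact congrArg _ (LinearMap.ext fun x => by simp [hπ])
  have h2 : ι ∘ₗ (Representation.ofModule' (k := ℚ) (G := G) I g ∘ₗ π) =
      LinearMap.mulLeft ℚ (MonoidAlgebra.of ℚ G g) ∘ₗ LinearMap.mulRight ℚ (m⁻¹ • c) := by
    exact LinearMap.ext fun x => congrArg Subtype.val (ofModule'_apply I g (π x))
  have h3 : idealChar (Ideal.span {c}) g = idealChar I g := rfl
  rw [h3, h1, h2, LinearMap.trace_eq_matrix_trace ℚ (MonoidAlgebra.basis G ℚ), Matrix.trace,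
    Finset.mul_sum]
  refine Finset.sum_congr rfl fun h _ => ?_
  rw [Matrix.diag_apply, LinearMap.toMatrix_apply, MonoidAlgebra.basis_apply]
  simp [MonoidAlgebra.basis, mul_assoc]
end GroupAlgebra

/-! ### Symmetrizers and antisymmetrizers of subsets -/

section CharSum

open Equiv

variable {α : Type*} [Fintype α] [DecidableEq α]

/-- The permutations that fix every point outside `A`. -/
def permsOn (A : Finset α) : Finset (Perm α) := {σ | ∀ i, i ∉ A → σ i = i}

theorem mem_permsOn {A : Finset α} {σ : Perm α} : σ ∈ permsOn A ↔ ∀ i, i ∉ A → σ i = i := by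
  simp [permsOn]

theorem mul_mem_permsOn {A : Finset α} {σ τ : Perm α} (hσ : σ ∈ permsOn A) (hτ : τ ∈ permsOn A) :
    σ * τ ∈ permsOn A :=
  mem_permsOn.2 fun i hi => by
    rw [Perm.mul_apply, mem_permsOn.1 hτ i hi, mem_permsOn.1 hσ i hi]

theorem inv_mem_permsOn {A : Finset α} {σ : Perm α} (hσ : σ ∈ permsOn A) : σ⁻¹ ∈ permsOn A :=
  mem_permsOn.2 fun i hi => by rw [Perm.inv_eq_iff_eq, mem_permsOn.1 hσ i hi]

theorem swap_mem_permsOn {A : Finset α} {i j : α} (hi : i ∈ A) (hj : j ∈ A) :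
    swap i j ∈ permsOn A :=
  mem_permsOn.2 fun k hk => swap_apply_of_ne_of_ne (by rintro rfl; exact hk hi)
    (by rintro rfl; exact hk hj)

theorem apply_mem_of_mem_permsOn {A : Finset α} {σ : Perm α} (hσ : σ ∈ permsOn A) {i : α} :
    σ i ∈ A ↔ i ∈ A := by
  by_cases hi : i ∈ A
  · refine iff_of_true ?_ hi
    by_contra h
    exact h (by rw [σ.injective (mem_permsOn.1 hσ _ h)]; exact hi)
  · rw [mem_permsOn.1 hσ i hi]

theorem permsOn_mono {A B : Finset α} (h : A ⊆ B) : permsOn A ⊆ permsOn B := fun _ hσ =>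
  mem_permsOn.2 fun i hi => mem_permsOn.1 hσ i fun h' => hi (h h')

theorem card_permsOn (A : Finset α) : (permsOn A).card = A.card ! := by
  have h := Fintype.card_congr (Perm.subtypeEquivSubtypePerm (fun i => i ∈ A))
  rw [Fintype.card_perm, Fintype.card_coe] at h
  rw [h, Fintype.card_subtype, permsOn]

/-- The sum over the permutations of `A` weighted by a linear character. -/
def charSum (ε : Perm α →* ℤˣ) (A : Finset α) : MonoidAlgebra ℚ (Perm α) :=
  ∑ p ∈ permsOn A, ((ε p : ℤ) : ℚ) • MonoidAlgebra.of ℚ _ p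

theorem intUnit_mul_self (u : ℤˣ) : ((u : ℤ) : ℚ) * ((u : ℤ) : ℚ) = 1 := by
  rw [← Int.cast_mul, ← Units.val_mul, Int.units_mul_self, Units.val_one, Int.cast_one]

theorem of_mul_charSum (ε : Perm α →* ℤˣ) (A : Finset α) {t : Perm α} (ht : t ∈ permsOn A) :
    MonoidAlgebra.of ℚ _ t * charSum ε A = ((ε t : ℤ) : ℚ) • charSum ε A := by
  simp only [charSum, Finset.mul_sum, Finset.smul_sum]
  refine Finset.sum_bij' (fun p _ => t * p) (fun p _ => t⁻¹ * p)
    (fun p hp => mul_mem_permsOn ht hp) (fun p hp => mul_mem_permsOn (inv_mem_permsOn ht) hp)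
    (fun p _ => inv_mul_cancel_left t p) (fun p _ => mul_inv_cancel_left t p) fun p _ => ?_
  rw [mul_smul_comm, ← map_mul, smul_smul, map_mul ε, Units.val_mul, Int.cast_mul, ← mul_assoc,
    intUnit_mul_self, one_mul]

theorem charSum_mul_of (ε : Perm α →* ℤˣ) (A : Finset α) {t : Perm α} (ht : t ∈ permsOn A) :
    charSum ε A * MonoidAlgebra.of ℚ _ t = ((ε t : ℤ) : ℚ) • charSum ε A := by
  simp only [charSum, Finset.sum_mul, Finset.smul_sum]
  refine Finset.sum_bij' (fun p _ => p * t) (fun p _ => p * t⁻¹)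
    (fun p hp => mul_mem_permsOn hp ht) (fun p hp => mul_mem_permsOn hp (inv_mem_permsOn ht))
    (fun p _ => mul_inv_cancel_right p t) (fun p _ => inv_mul_cancel_right p t) fun p _ => ?_
  rw [smul_mul_assoc, ← map_mul, smul_smul, map_mul ε, Units.val_mul, Int.cast_mul,
    mul_comm ((ε p : ℤ) : ℚ), ← mul_assoc, intUnit_mul_self, one_mul]

theorem charSum_mul_self (ε : Perm α →* ℤˣ) (A : Finset α) :
    charSum ε A * charSum ε A = (A.card ! : ℚ) • charSum ε A := by
  nth_rewrite 1 [charSum]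
  rw [Finset.sum_mul, Finset.sum_congr rfl (g := fun _ => charSum ε A), Finset.sum_const, card_permsOn,
    Nat.cast_smul_eq_nsmul]
  intro p hp
  rw [smul_mul_assoc, of_mul_charSum ε A hp, smul_smul, intUnit_mul_self, one_smul]

theorem of_mul_charSum_eq (ε : Perm α →* ℤˣ) (A : Finset α) (σ : Perm α) :
    MonoidAlgebra.of ℚ _ σ * charSum ε A =
      charSum ε (A.map σ.toEmbedding) * MonoidAlgebra.of ℚ _ σ := by
  simp only [charSum, Finset.mul_sum, Finset.sum_mul]
  refine Finset.sum_bij' (fun p _ => σ * p * σ⁻¹) (fun p _ => σ⁻¹ * p * σ) ?_ ?_ ?_ ?_ ?_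
  · intro p hp
    refine mem_permsOn.2 fun i hi => ?_
    rw [Perm.mul_apply, Perm.mul_apply, mem_permsOn.1 hp]
    · simp
    · exact fun h => hi (Finset.mem_map.2 ⟨_, h, by simp⟩)
  · intro p hp
    refine mem_permsOn.2 fun i hi => ?_
    rw [Perm.mul_apply, Perm.mul_apply, mem_permsOn.1 hp]
    · simp
    · intro h
      obtain ⟨j, hj, hji⟩ := Finset.mem_map.1 h
      exact hi (by rwa [σ.injective hji] at hj)
  · intro p _; group
  · intro p _; group
  · intro p _
    rw [mul_smul_comm, smul_mul_assoc, ← map_mul, ← map_mul, inv_mul_cancel_right, map_mul ε,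
      map_mul ε, mul_comm (ε σ), mul_assoc, map_inv, mul_inv_cancel, mul_one]

/-- Coset decomposition: `σ` is determined by `y = σ⁻¹ s` and by `σ * swap y s`, which fixes `s`.
The primed version uses `y = σ s` instead, placing the transpositions on the left. -/
theorem charSum_insert (ε : Perm α →* ℤˣ) {A : Finset α} {s : α} (hs : s ∉ A) :
    charSum ε (insert s A) = charSum ε A *
      ∑ y ∈ insert s A, ((ε (swap y s) : ℤ) : ℚ) • MonoidAlgebra.of ℚ _ (swap y s) := by
  rw [charSum, charSum, Finset.sum_mul_sum, ← Finset.sum_product']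
  have hsub := permsOn_mono (Finset.subset_insert s A)
  refine Finset.sum_bij' (fun σ _ => (σ * swap (σ⁻¹ s) s, σ⁻¹ s)) (fun p _ => p.1 * swap p.2 s)
    ?_ ?_ ?_ ?_ ?_
  · intro σ hσ
    have h1 : σ⁻¹ s ∈ insert s A :=
      (apply_mem_of_mem_permsOn (inv_mem_permsOn hσ)).2 (Finset.mem_insert_self s A)
    refine Finset.mem_product.2 ⟨mem_permsOn.2 fun i hi => ?_, h1⟩
    by_cases his : i = s
    · subst his
      simp
    · exact mem_permsOn.1 (mul_mem_permsOn hσ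
        (swap_mem_permsOn h1 (Finset.mem_insert_self s A))) i (by simp [his, hi])
  · rintro ⟨p, y⟩ h
    obtain ⟨hp, hy⟩ := Finset.mem_product.1 h
    exact mul_mem_permsOn (hsub hp) (swap_mem_permsOn hy (Finset.mem_insert_self s A))
  · intro σ _
    simp [mul_assoc]
  · rintro ⟨p, y⟩ h
    have hp : p⁻¹ s = s :=
      mem_permsOn.1 (inv_mem_permsOn (Finset.mem_product.1 h).1) s hs
    simp only [mul_inv_rev, swap_inv, Perm.mul_apply, hp, swap_apply_right, mul_assoc,
      swap_mul_self, mul_one]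
  · intro σ _
    rw [smul_mul_smul_comm, ← map_mul, mul_assoc, swap_mul_self, mul_one, ← Int.cast_mul,
      ← Units.val_mul, ← map_mul, mul_assoc, swap_mul_self, mul_one]

theorem charSum_insert' (ε : Perm α →* ℤˣ) {A : Finset α} {s : α} (hs : s ∉ A) :
    charSum ε (insert s A) =
      (∑ y ∈ insert s A, ((ε (swap y s) : ℤ) : ℚ) • MonoidAlgebra.of ℚ _ (swap y s)) *
        charSum ε A := by
  rw [charSum, charSum, Finset.sum_mul_sum, ← Finset.sum_product']
  have hsub := permsOn_mono (Finset.subset_insert s A)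
  refine Finset.sum_bij' (fun σ _ => (σ s, swap (σ s) s * σ)) (fun p _ => swap p.1 s * p.2)
    ?_ ?_ ?_ ?_ ?_
  · intro σ hσ
    have h1 : σ s ∈ insert s A := (apply_mem_of_mem_permsOn hσ).2 (Finset.mem_insert_self s A)
    refine Finset.mem_product.2 ⟨h1, mem_permsOn.2 fun i hi => ?_⟩
    by_cases his : i = s
    · subst his
      simp
    · exact mem_permsOn.1 (mul_mem_permsOn
        (swap_mem_permsOn h1 (Finset.mem_insert_self s A)) hσ) i (by simp [his, hi])
  · rintro ⟨y, p⟩ h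
    obtain ⟨hy, hp⟩ := Finset.mem_product.1 h
    exact mul_mem_permsOn (swap_mem_permsOn hy (Finset.mem_insert_self s A)) (hsub hp)
  · intro σ _
    simp [← mul_assoc]
  · rintro ⟨y, p⟩ h
    have hp : p s = s := mem_permsOn.1 (Finset.mem_product.1 h).2 s hs
    simp [hp, ← mul_assoc]
  · intro σ _
    rw [smul_mul_smul_comm, ← map_mul, ← mul_assoc, swap_mul_self, one_mul, ← Int.cast_mul,
      ← Units.val_mul, ← map_mul, ← mul_assoc, swap_mul_self, one_mul]

/-- The symmetrizer of `A`. -/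
abbrev symSum (A : Finset α) : MonoidAlgebra ℚ (Perm α) := charSum 1 A

/-- The antisymmetrizer of `A`. -/
abbrev altSum (A : Finset α) : MonoidAlgebra ℚ (Perm α) := charSum Perm.sign A

theorem eq_zero_of_eq_neg {G : Type*} [Group G] {a : MonoidAlgebra ℚ G} (h : a = -a) : a = 0 := by
  have h4 : (2 : ℚ) • a = 0 := by
    rw [two_smul]
    nth_rewrite 1 [h]
    exact neg_add_cancel _
  exact (smul_eq_zero.1 h4).resolve_left two_ne_zero

/-- The transposition of two common points can be inserted between the factors; the symmetrizer
absorbs it and the antisymmetrizer changes sign. -/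
theorem symSum_mul_altSum_eq_zero {A B : Finset α} {i j : α} (hij : i ≠ j) (hiA : i ∈ A)
    (hjA : j ∈ A) (hiB : i ∈ B) (hjB : j ∈ B) : symSum A * altSum B = 0 := by
  have h1 := charSum_mul_of 1 A (swap_mem_permsOn hiA hjA)
  have h2 := of_mul_charSum Perm.sign B (swap_mem_permsOn hiB hjB)
  rw [Perm.sign_swap hij] at h2
  simp only [MonoidHom.one_apply, Units.val_one, Int.cast_one, one_smul, Units.val_neg,
    Int.cast_neg, neg_smul] at h1 h2
  have h3 : symSum A * altSum B = -(symSum A * altSum B) := by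
    conv_lhs => rw [symSum, ← h1, mul_assoc, h2, mul_neg]
  exact eq_zero_of_eq_neg h3

theorem symSum_insert {A : Finset α} {s : α} (hs : s ∉ A) :
    symSum (insert s A) = symSum A * (1 + ∑ y ∈ A, MonoidAlgebra.of ℚ _ (swap y s)) := by
  rw [symSum, charSum_insert 1 hs, Finset.sum_insert hs]
  simp [MonoidAlgebra.one_def, Perm.one_def]

theorem symSum_insert' {A : Finset α} {s : α} (hs : s ∉ A) :
    symSum (insert s A) = (1 + ∑ y ∈ A, MonoidAlgebra.of ℚ _ (swap y s)) * symSum A := by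
  rw [symSum, charSum_insert' 1 hs, Finset.sum_insert hs]
  simp [MonoidAlgebra.one_def, Perm.one_def]

theorem sum_sign_swap_eq {S : Finset α} {x : α} (hx : x ∉ S) :
    ∑ y ∈ insert x S, ((Perm.sign (swap y x) : ℤ) : ℚ) • MonoidAlgebra.of ℚ _ (swap y x) =
      1 - ∑ y ∈ S, MonoidAlgebra.of ℚ _ (swap y x) := by
  rw [Finset.sum_insert hx, sub_eq_add_neg, ← Finset.sum_neg_distrib]
  congr 1
  · simp [MonoidAlgebra.one_def, Perm.one_def]
  · refine Finset.sum_congr rfl fun y hy => ?_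
    rw [Perm.sign_swap (by rintro rfl; exact hx hy)]
    simp

theorem altSum_insert {S : Finset α} {x : α} (hx : x ∉ S) :
    altSum (insert x S) = altSum S * (1 - ∑ y ∈ S, MonoidAlgebra.of ℚ _ (swap y x)) := by
  rw [altSum, charSum_insert _ hx, sum_sign_swap_eq hx]

theorem altSum_insert' {S : Finset α} {x : α} (hx : x ∉ S) :
    altSum (insert x S) = (1 - ∑ y ∈ S, MonoidAlgebra.of ℚ _ (swap y x)) * altSum S := by
  rw [altSum, charSum_insert' _ hx, sum_sign_swap_eq hx]

omit [Fintype α] in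
theorem map_swap_insert {A : Finset α} {i j : α} (hi : i ∉ A) (hj : j ∉ A) :
    (insert i A).map (swap i j).toEmbedding = insert j A := by
  ext k
  simp only [Finset.mem_map_equiv, symm_swap, Finset.mem_insert]
  by_cases hki : k = i
  · subst hki; simp [swap_apply_left, hj, hi, eq_comm]
  by_cases hkj : k = j
  · subst hkj; simp
  · rw [swap_apply_of_ne_of_ne hki hkj]; simp [hki, hkj]

/-- Conjugation by `swap s t` carries `insert s A` to `insert t A`, and `altSum S` absorbs the
transposition up to sign. Hence the left ideal of the product does not depend on the point moved
from `S` to `A`. -/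
theorem symSum_insert_mul_altSum {A S : Finset α} (h : Disjoint A S) {s t : α} (hs : s ∈ S)
    (ht : t ∈ S) : symSum (insert t A) * altSum S =
      (((Perm.sign (swap s t) : ℤ) : ℚ) • MonoidAlgebra.of ℚ _ (swap s t)) *
        (symSum (insert s A) * altSum S) := by
  have hsA : s ∉ A := fun h' => Finset.disjoint_left.1 h h' hs
  have htA : t ∉ A := fun h' => Finset.disjoint_left.1 h h' ht
  rw [← mul_assoc, smul_mul_assoc, of_mul_charSum_eq, map_swap_insert hsA htA, smul_mul_assoc,
    mul_assoc, of_mul_charSum _ _ (swap_mem_permsOn hs ht), mul_smul_comm, smul_smul,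
    intUnit_mul_self, one_smul]

/-- This is the splitting of an induced module into two neighbours. Right multiplication by `r` maps
the middle ideal onto the one of `altSum (insert x S)` and kills the one of `symSum (insert s A)`;
the point is that its kernel is no larger. -/
theorem idealChar_symSum_mul_altSum {A S : Finset α} (h : Disjoint A S) {x s : α} (hx : x ∈ A)
    (hs : s ∈ S) (g : Perm α) :
    idealChar (Ideal.span {symSum A * altSum S}) g =
      idealChar (Ideal.span {symSum (insert s A) * altSum S}) g +
        idealChar (Ideal.span {symSum A * altSum (insert x S)}) g := by
  have hA : ∀ t ∈ S, t ∉ A := fun t ht h' => Finset.disjoint_left.1 h h' ht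
  have hS : ∀ y ∈ A, y ∉ S := fun y hy h' => Finset.disjoint_left.1 h hy h'
  set r : MonoidAlgebra ℚ (Perm α) := 1 - ∑ y ∈ S, MonoidAlgebra.of ℚ _ (swap y x) with hr
  have hV : symSum A * altSum S * r = symSum A * altSum (insert x S) := by
    rw [altSum_insert (hS x hx), mul_assoc]
  have hN : symSum (insert s A) * altSum S * r = 0 := by
    rw [mul_assoc, ← altSum_insert (hS x hx)]
    exact symSum_mul_altSum_eq_zero (i := x) (j := s) (by rintro rfl; exact hS x hx hs)
      (Finset.mem_insert_of_mem hx) (Finset.mem_insert_self _ _) (Finset.mem_insert_self _ _)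
      (Finset.mem_insert_of_mem hs)
  have hNM : Ideal.span {symSum (insert s A) * altSum S} ≤
      Ideal.span {symSum A * altSum S} := by
    rw [Ideal.span_singleton_le_iff_mem, symSum_insert' (hA s hs), mul_assoc]
    exact Ideal.mul_mem_left _ _ (Ideal.mem_span_singleton_self _)
  have hMV : ∀ z ∈ Ideal.span {symSum A * altSum S},
      LinearMap.toSpanSingleton (MonoidAlgebra ℚ (Perm α)) _ r z ∈
        Ideal.span {symSum A * altSum (insert x S)} := by
    intro z hz
    obtain ⟨u, rfl⟩ := Ideal.mem_span_singleton'.1 hz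
    rw [LinearMap.toSpanSingleton_apply, smul_eq_mul, mul_assoc, hV]
    exact Ideal.mul_mem_left _ _ (Ideal.mem_span_singleton_self _)
  refine idealChar_add_of_exact (Submodule.inclusion hNM)
    ((LinearMap.toSpanSingleton (MonoidAlgebra ℚ (Perm α)) _ r).restrict hMV)
    (Submodule.inclusion_injective hNM) ?_ ?_ g
  · rintro ⟨v, hv⟩
    obtain ⟨u, rfl⟩ := Ideal.mem_span_singleton'.1 hv
    refine ⟨⟨u * (symSum A * altSum S), Ideal.mul_mem_left _ _ (Ideal.mem_span_singleton_self _)⟩,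
      Subtype.ext ?_⟩
    change u * (symSum A * altSum S) * r = _
    rw [mul_assoc, hV]
  · rintro ⟨z, hz⟩
    constructor
    · intro hz0
      obtain ⟨u, rfl⟩ := Ideal.mem_span_singleton'.1 hz
      have h0 : u * (symSum A * altSum (insert x S)) = 0 := by
        have := congrArg Subtype.val hz0
        change u * (symSum A * altSum S) * r = 0 at this
        rwa [mul_assoc, hV] at this
      -- The point `x` plays no special role: `symSum A` absorbs `swap x y` on its right, and
      -- conjugation by it moves `x` to `y`.
      have hy : ∀ y ∈ A, u * symSum A * altSum (insert y S) = 0 := by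
        intro y hy
        have h1 := charSum_mul_of 1 A (swap_mem_permsOn hx hy)
        simp only [MonoidHom.one_apply, Units.val_one, Int.cast_one, one_smul] at h1
        have h2 := of_mul_charSum_eq Perm.sign (insert x S) (swap x y)
        rw [map_swap_insert (hS x hx) (hS y hy)] at h2
        have h3 : altSum (insert y S) = MonoidAlgebra.of ℚ _ (swap x y) * altSum (insert x S) *
            MonoidAlgebra.of ℚ _ (swap x y) := by
          rw [h2, mul_assoc, ← map_mul, swap_mul_self, map_one, mul_one]
        rw [h3, ← mul_assoc, ← mul_assoc, mul_assoc u, symSum, h1, mul_assoc u, h0, zero_mul]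
      -- Expanding `altSum (insert y S)` on the left rewrites `z = u * symSum A * altSum S` as a sum
      -- of transposition terms over `t ∈ S`. Summed over `y ∈ A` these make `|A| z`; they are also
      -- the terms other than `z` in the expansions of `symSum (insert t A)`, which supply `|S|`
      -- more copies. Division by `|A| + |S|` then puts `z` in the smaller ideal.
      have hsum : (∑ t ∈ S, u * symSum (insert t A) * altSum S) =
          ((A.card + S.card : ℕ) : ℚ) • (u * (symSum A * altSum S)) := by
        have h1 : ∀ y ∈ A, u * symSum A * altSum S =
            ∑ t ∈ S, u * symSum A * MonoidAlgebra.of ℚ _ (swap t y) * altSum S := by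
          intro y hyA
          have := hy y hyA
          rw [altSum_insert' (hS y hyA), sub_mul, one_mul, mul_sub, sub_eq_zero] at this
          rw [this, Finset.sum_mul, Finset.mul_sum]
          simp only [mul_assoc]
        have h2 := Finset.sum_congr (rfl : A = A) h1
        rw [Finset.sum_const, Finset.sum_comm] at h2
        have h3 : ∀ t ∈ S, u * symSum (insert t A) * altSum S = u * symSum A * altSum S +
            ∑ y ∈ A, u * symSum A * MonoidAlgebra.of ℚ _ (swap t y) * altSum S := by
          intro t ht
          rw [symSum_insert (hA t ht), mul_add, mul_one, mul_add, add_mul, Finset.mul_sum,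
            Finset.mul_sum, Finset.sum_mul]
          congr 1
          refine Finset.sum_congr rfl fun y _ => ?_
          rw [swap_comm y t, ← mul_assoc]
        rw [Finset.sum_congr rfl h3, Finset.sum_add_distrib, ← h2, Finset.sum_const, ← add_smul,
          Nat.cast_smul_eq_nsmul, mul_assoc, add_comm]
      have hcard : ((A.card + S.card : ℕ) : ℚ) ≠ 0 :=
        Nat.cast_ne_zero.2 (by have := Finset.card_pos.2 ⟨x, hx⟩; omega)
      have hmem : u * (symSum A * altSum S) ∈ Ideal.span {symSum (insert s A) * altSum S} := by
        have h4 : u * (symSum A * altSum S) = ((A.card + S.card : ℕ) : ℚ)⁻¹ •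
            ∑ t ∈ S, u * symSum (insert t A) * altSum S := by
          rw [hsum, smul_smul, inv_mul_cancel₀ hcard, one_smul]
        rw [h4]
        refine Submodule.smul_of_tower_mem _ _ (Submodule.sum_mem _ fun t ht => ?_)
        rw [mul_assoc, symSum_insert_mul_altSum h hs ht]
        exact Ideal.mul_mem_left _ _ (Ideal.mul_mem_left _ _ (Ideal.mem_span_singleton_self _))
      exact ⟨⟨_, hmem⟩, rfl⟩
    · rintro ⟨⟨w, hw⟩, hwz⟩
      obtain ⟨u, rfl⟩ := Ideal.mem_span_singleton'.1 hw
      have h1 : z = u * (symSum (insert s A) * altSum S) := (congrArg Subtype.val hwz).symm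
      apply Subtype.ext
      change z * r = 0
      rw [h1, mul_assoc, hN, mul_zero]

end CharSum

/-! ### Characters of exterior powers of the permutation representation -/

section Exterior

open Equiv

variable {α : Type*} [Fintype α] [DecidableEq α]

/-- The sign of the restriction of `g` to `S`, or `0` if `S` is not invariant. -/
def signOn (g : Perm α) (S : Finset α) : ℚ :=
  if h : ∀ x, g x ∈ S ↔ x ∈ S then ((Perm.sign (g.subtypePerm h) : ℤ) : ℚ) else 0

theorem mem_permsOn_compl_iff {g q : Perm α} {S : Finset α} :
    g * q⁻¹ ∈ permsOn Sᶜ ↔ ∀ x, q x ∈ S → g x = q x := by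
  rw [mem_permsOn]
  constructor
  · intro h x hx
    simpa using h (q x) (by simpa using hx)
  · intro h i hi
    simpa using h (q⁻¹ i) (by simpa using hi)

/-- A factorization `g = p q`, with `p` supported off `S` and `q` on `S`, exists exactly when `g`
preserves `S`; then `q` is forced to be the restriction of `g` to `S`. -/
theorem coeff_symSum_mul_altSum (g : Perm α) (S : Finset α) :
    (symSum Sᶜ * altSum S).coeff g = signOn g S := by
  have h1 : (symSum Sᶜ * altSum S).coeff g =
      ∑ q ∈ permsOn S, if g * q⁻¹ ∈ permsOn Sᶜ then ((Perm.sign q : ℤ) : ℚ) else 0 := by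
    have h2 : symSum Sᶜ * altSum S = ∑ q ∈ permsOn S, ∑ p ∈ permsOn Sᶜ,
        MonoidAlgebra.single (p * q) ((Perm.sign q : ℤ) : ℚ) := by
      rw [symSum, altSum, charSum, charSum, Finset.sum_mul_sum, Finset.sum_comm]
      simp [MonoidAlgebra.single_mul_single]
    rw [h2]
    simp only [MonoidAlgebra.coeff_sum, Finsupp.coe_finsetSum, Finset.sum_apply,
      MonoidAlgebra.coeff_single, Finsupp.single_apply]
    refine Finset.sum_congr rfl fun q _ => ?_
    simp only [← eq_mul_inv_iff_mul_eq]
    rw [Finset.sum_ite_eq']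
  rw [h1, signOn]
  split_ifs with h
  · rw [Finset.sum_eq_single (Perm.ofSubtype (g.subtypePerm h))]
    · rw [if_pos, Perm.sign_ofSubtype]
      rw [mem_permsOn_compl_iff]
      intro x hx
      by_cases hxS : x ∈ S
      · rw [Perm.ofSubtype_apply_of_mem _ hxS]; rfl
      · rw [Perm.ofSubtype_apply_of_not_mem _ hxS] at hx
        exact absurd hx hxS
    · intro q hq hne
      rw [if_neg]
      intro hgq
      rw [mem_permsOn_compl_iff] at hgq
      apply hne
      ext x
      by_cases hxS : x ∈ S
      · rw [Perm.ofSubtype_apply_of_mem _ hxS, ← hgq x ((apply_mem_of_mem_permsOn hq).2 hxS)]; rfl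
      · rw [Perm.ofSubtype_apply_of_not_mem _ hxS, mem_permsOn.1 hq x hxS]
    · intro hn
      exact absurd (mem_permsOn.2 fun i hi => Perm.ofSubtype_apply_of_not_mem _ hi) hn
  · refine Finset.sum_eq_zero fun q hq => if_neg fun hgq => h ?_
    rw [mem_permsOn_compl_iff] at hgq
    have h3 : ∀ x ∈ S, g x ∈ S := fun x hx => by
      have := (apply_mem_of_mem_permsOn hq).2 hx
      rwa [hgq x this]
    have h4 : S.image g = S := Finset.eq_of_subset_of_card_le
      (Finset.image_subset_iff.2 h3) (Finset.card_image_of_injective _ g.injective).ge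
    intro x
    refine ⟨fun hx => ?_, h3 x⟩
    rw [← h4] at hx
    obtain ⟨y, hy, hyx⟩ := Finset.mem_image.1 hx
    rwa [← g.injective hyx]

theorem commute_charSum_of_disjoint (ε δ : Perm α →* ℤˣ) {A B : Finset α} (h : Disjoint A B) :
    Commute (charSum ε A) (charSum δ B) := by
  refine Commute.sum_left _ _ _ fun p hp => Commute.sum_right _ _ _ fun q hq => ?_
  refine Commute.smul_left (Commute.smul_right ?_ _) _
  have hpq : Commute p q := by
    refine Perm.Disjoint.commute fun i => ?_
    by_cases hi : i ∈ A
    · exact Or.inr (mem_permsOn.1 hq i (Finset.disjoint_left.1 h hi))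
    · exact Or.inl (mem_permsOn.1 hp i hi)
  exact hpq.map (MonoidAlgebra.of ℚ (Perm α))

theorem symSum_mul_altSum_mul_self (S : Finset α) :
    (symSum Sᶜ * altSum S) * (symSum Sᶜ * altSum S) =
      ((Sᶜ.card ! * S.card ! : ℕ) : ℚ) • (symSum Sᶜ * altSum S) := by
  have hc := commute_charSum_of_disjoint 1 Perm.sign (disjoint_compl_left : Disjoint Sᶜ S)
  rw [mul_assoc, ← mul_assoc (altSum S), ← hc.eq, mul_assoc, charSum_mul_self, ← mul_assoc,
    charSum_mul_self, smul_mul_smul_comm, Nat.cast_mul]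

theorem coeff_conj (S : Finset α) (g h : Perm α) :
    (symSum Sᶜ * altSum S).coeff (h⁻¹ * g * h) = signOn g (S.map h.toEmbedding) := by
  have h1 : MonoidAlgebra.of ℚ _ h * (symSum Sᶜ * altSum S) =
      symSum (S.map h.toEmbedding)ᶜ * altSum (S.map h.toEmbedding) * MonoidAlgebra.of ℚ _ h := by
    rw [← mul_assoc, of_mul_charSum_eq, mul_assoc, of_mul_charSum_eq, ← mul_assoc]
    congr 3
    ext x
    simp [Finset.mem_map_equiv]
  have key : ∀ z w : MonoidAlgebra ℚ (Perm α), MonoidAlgebra.of ℚ _ h * z =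
      w * MonoidAlgebra.of ℚ _ h → z.coeff (h⁻¹ * g * h) = w.coeff g := by
    intro z w hzw
    have h2 := congrArg (fun z => z.coeff (g * h)) hzw
    simpa [mul_assoc] using h2
  rw [key _ _ h1, coeff_symSum_mul_altSum]

/-- The group acts transitively on the subsets of a given size, so all fibres are equal; `|α|!`
divided by the binomial coefficient is their common size. -/
theorem card_perm_map_eq {S S' : Finset α} (h : S'.card = S.card) :
    (Finset.univ.filter fun σ : Perm α => S.map σ.toEmbedding = S').card =
      Sᶜ.card ! * S.card ! := by
  have hconst : ∀ S₁ ∈ Finset.powersetCard S.card (Finset.univ : Finset α),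
      (Finset.univ.filter fun σ : Perm α => S.map σ.toEmbedding = S₁).card =
      (Finset.univ.filter fun σ : Perm α => S.map σ.toEmbedding = S').card := by
    intro S₁ hS₁
    have hc : S₁.card = S'.card := by rw [h, (Finset.mem_powersetCard.1 hS₁).2]
    obtain ⟨τ, hτ⟩ : ∃ τ : Perm α, S₁.map τ.toEmbedding = S' := by
      obtain ⟨e⟩ : Nonempty ({x // x ∈ S₁} ≃ {x // x ∈ S'}) :=
        ⟨Fintype.equivOfCardEq (by simpa using hc)⟩
      refine ⟨e.extendSubtype, Finset.eq_of_subset_of_card_le (fun y hy => ?_) (by simp [hc])⟩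
      obtain ⟨x, hx, rfl⟩ := Finset.mem_map.1 hy
      exact e.extendSubtype_mem x hx
    refine Finset.card_bij' (fun σ _ => τ * σ) (fun σ _ => τ⁻¹ * σ) ?_ ?_ ?_ ?_
    · intro σ hσ
      rw [Finset.mem_filter] at hσ ⊢
      refine ⟨Finset.mem_univ _, ?_⟩
      rw [← hτ, ← hσ.2, Finset.map_map]
      rfl
    · intro σ hσ
      rw [Finset.mem_filter] at hσ ⊢
      refine ⟨Finset.mem_univ _, Finset.map_injective τ.toEmbedding ?_⟩
      rw [hτ, ← hσ.2, Finset.map_map]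
      congr 1
      ext x
      simp
    · intro σ _; simp
    · intro σ _; simp
  have htot : ∑ S₁ ∈ Finset.powersetCard S.card (Finset.univ : Finset α),
      (Finset.univ.filter fun σ : Perm α => S.map σ.toEmbedding = S₁).card =
        (Fintype.card α)! := by
    rw [← Finset.card_eq_sum_card_fiberwise, Finset.card_univ, Fintype.card_perm]
    intro σ _
    simp [Finset.mem_powersetCard]
  rw [Finset.sum_congr rfl hconst, Finset.sum_const, Finset.card_powersetCard, Finset.card_univ,
    smul_eq_mul] at htot
  have hle := Finset.card_le_univ S
  have hf := Nat.choose_mul_factorial_mul_factorial hle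
  rw [← htot, mul_assoc] at hf
  rw [Finset.card_compl, mul_comm]
  exact (Nat.eq_of_mul_eq_mul_left (Nat.choose_pos hle) hf).symm

/-- This is the trace on an exterior power in the basis of wedges indexed by subsets. Conjugation by
`h` moves `S` over all subsets of its size, each hit as often as the scalar of the quasi-idempotent.
The inverse of `g` is harmless, having the same cycle type. -/
theorem idealChar_exterior (g : Perm α) (S : Finset α) :
    idealChar (Ideal.span {symSum Sᶜ * altSum S}) g =
      ∑ S' ∈ Finset.powersetCard S.card Finset.univ, signOn g⁻¹ S' := by
  have hm : ((Sᶜ.card ! * S.card ! : ℕ) : ℚ) ≠ 0 :=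
    Nat.cast_ne_zero.2 (mul_ne_zero (Nat.factorial_ne_zero _) (Nat.factorial_ne_zero _))
  rw [idealChar_of_quasi_idempotent _ _ hm (symSum_mul_altSum_mul_self S)]
  simp only [coeff_conj]
  rw [inv_mul_eq_iff_eq_mul₀ hm, Finset.mul_sum,
    ← Finset.sum_fiberwise_of_maps_to (t := Finset.powersetCard S.card Finset.univ)
      (g := fun h : Perm α => S.map h.toEmbedding) (by simp [Finset.mem_powersetCard])]
  refine Finset.sum_congr rfl fun S' hS' => ?_
  rw [Finset.sum_congr rfl (g := fun _ => signOn g⁻¹ S')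
    (fun h hh => by rw [(Finset.mem_filter.1 hh).2]), Finset.sum_const,
    card_perm_map_eq (Finset.mem_powersetCard.1 hS').2, nsmul_eq_mul]

end Exterior

/-! ### Orbits of a permutation and the characters of hooks -/

section Orbits

open Equiv Classical

variable {α : Type*} [Fintype α]

/-- The set of orbits of a permutation. -/
abbrev Orb (g : Perm α) : Type _ := Quotient (Perm.SameCycle.setoid g)

/-- The orbit of a point. -/
def toOrb (g : Perm α) (x : α) : Orb g := Quotient.mk (Perm.SameCycle.setoid g) x

/-- The union of a set of orbits. -/
def orbUnion (g : Perm α) (T : Finset (Orb g)) : Finset α := {x | toOrb g x ∈ T}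

omit [Fintype α] in
theorem toOrb_eq_iff {g : Perm α} {x y : α} : toOrb g x = toOrb g y ↔ g.SameCycle x y :=
  Quotient.eq (r := Perm.SameCycle.setoid g)

omit [Fintype α] in
theorem toOrb_surjective (g : Perm α) : Function.Surjective (toOrb g) := Quotient.mk_surjective

omit [Fintype α] in
theorem toOrb_apply (g : Perm α) (x : α) : toOrb g (g x) = toOrb g x :=
  toOrb_eq_iff.2 (Perm.sameCycle_apply_left.2 (Perm.SameCycle.refl g x))

theorem mem_orbUnion {g : Perm α} {T : Finset (Orb g)} {x : α} :
    x ∈ orbUnion g T ↔ toOrb g x ∈ T := by simp [orbUnion]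

theorem apply_mem_orbUnion (g : Perm α) (T : Finset (Orb g)) (x : α) :
    g x ∈ orbUnion g T ↔ x ∈ orbUnion g T := by
  rw [mem_orbUnion, mem_orbUnion, toOrb_apply]

theorem orbUnion_injective (g : Perm α) : Function.Injective (orbUnion g) := by
  intro T T' h
  ext ω
  obtain ⟨x, rfl⟩ := toOrb_surjective g ω
  rw [← mem_orbUnion, h, mem_orbUnion]

theorem exists_orbUnion_eq {g : Perm α} {S : Finset α} (hS : ∀ x, g x ∈ S ↔ x ∈ S) :
    ∃ T, orbUnion g T = S := by
  refine ⟨S.image (toOrb g), ?_⟩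
  ext x
  rw [mem_orbUnion, Finset.mem_image]
  refine ⟨?_, fun hx => ⟨x, hx, rfl⟩⟩
  rintro ⟨y, hy, hyx⟩
  obtain ⟨k, rfl⟩ := toOrb_eq_iff.1 hyx
  have hz : ∀ k : ℤ, (g ^ k) y ∈ S ↔ y ∈ S := by
    intro k
    have h2 := ((g.subtypePerm hS ^ k) ⟨y, hy⟩).2
    rw [Perm.subtypePerm_zpow] at h2
    exact iff_of_true h2 hy
  exact (hz k).2 hy

theorem orbUnion_singleton (g : Perm α) (x : α) (y : α) :
    y ∈ orbUnion g {toOrb g x} ↔ g.SameCycle x y := by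
  rw [mem_orbUnion, Finset.mem_singleton, toOrb_eq_iff, Perm.sameCycle_comm]

theorem orbUnion_singleton_of_fixed {g : Perm α} {x : α} (hx : g x = x) :
    orbUnion g {toOrb g x} = {x} := by
  ext y
  rw [orbUnion_singleton, Finset.mem_singleton]
  refine ⟨fun h => ?_, fun h => h ▸ Perm.SameCycle.refl g x⟩
  exact (Perm.SameCycle.eq_of_left h hx).symm

variable [DecidableEq α]

theorem orbUnion_singleton_of_not_fixed {g : Perm α} {x : α} (hx : g x ≠ x) :
    orbUnion g {toOrb g x} = (g.cycleOf x).support := by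
  ext y
  rw [orbUnion_singleton, Perm.mem_support_cycleOf_iff' hx]

/-- A cycle of length `ℓ` has sign `(-1)^(ℓ-1)`, so each orbit, fixed points included, contributes a
single factor `-1`. -/
theorem sign_restrict_orbUnion (g : Perm α) (T : Finset (Orb g)) :
    ((Perm.sign (Perm.ofSubtype (g.subtypePerm (apply_mem_orbUnion g T))) : ℤ) : ℚ) *
      (-1) ^ (orbUnion g T).card = (-1) ^ T.card := by
  induction T using Finset.induction_on with
  | empty =>
    have h0 : orbUnion g ∅ = ∅ := by ext x; simp [mem_orbUnion]
    have h1 : Perm.ofSubtype (g.subtypePerm (apply_mem_orbUnion g ∅)) = 1 := by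
      ext x
      rw [Perm.ofSubtype_apply_of_not_mem _ (by simp [h0]), Perm.one_apply]
    rw [h1, h0]
    simp
  | insert ω T hω ih =>
    obtain ⟨x, rfl⟩ := toOrb_surjective g ω
    have hun : orbUnion g (insert (toOrb g x) T) = orbUnion g {toOrb g x} ∪ orbUnion g T := by
      ext y
      simp [mem_orbUnion]
    have hdis : Disjoint (orbUnion g {toOrb g x}) (orbUnion g T) := by
      rw [Finset.disjoint_left]
      intro y hy hy'
      rw [mem_orbUnion] at hy hy'
      exact hω (Finset.mem_singleton.1 hy ▸ hy')
    have hmul : Perm.ofSubtype (g.subtypePerm (apply_mem_orbUnion g (insert (toOrb g x) T))) =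
        g.cycleOf x * Perm.ofSubtype (g.subtypePerm (apply_mem_orbUnion g T)) := by
      ext y
      rw [Perm.mul_apply]
      by_cases hyT : y ∈ orbUnion g T
      · have hgy : g y ∈ orbUnion g T := (apply_mem_orbUnion g T y).2 hyT
        rw [Perm.ofSubtype_apply_of_mem _ hyT,
          Perm.ofSubtype_apply_of_mem _ (hun ▸ Finset.mem_union_right _ hyT)]
        change g y = g.cycleOf x (g y)
        rw [Perm.cycleOf_apply_of_not_sameCycle]
        rw [← orbUnion_singleton]
        exact Finset.disjoint_right.1 hdis hgy
      · rw [Perm.ofSubtype_apply_of_not_mem _ hyT]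
        by_cases hyx : y ∈ orbUnion g {toOrb g x}
        · rw [Perm.ofSubtype_apply_of_mem _ (hun ▸ Finset.mem_union_left _ hyx),
            Perm.SameCycle.cycleOf_apply ((orbUnion_singleton g x y).1 hyx)]
          rfl
        · rw [Perm.ofSubtype_apply_of_not_mem _ (by rw [hun]; simp [hyT, hyx]),
            Perm.cycleOf_apply_of_not_sameCycle]
          rwa [← orbUnion_singleton]
    have hsign : ((Perm.sign (g.cycleOf x) : ℤ) : ℚ) * (-1) ^ (orbUnion g {toOrb g x}).card =
        -1 := by
      by_cases hx : g x = x
      · rw [orbUnion_singleton_of_fixed hx, (Perm.cycleOf_eq_one_iff g).2 hx]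
        simp
      · rw [orbUnion_singleton_of_not_fixed hx, (Perm.isCycle_cycleOf g hx).sign]
        push_cast
        rw [neg_mul, ← mul_pow]
        simp
    rw [hmul, hun, Finset.card_union_of_disjoint hdis, Finset.card_insert_of_notMem hω, map_mul,
      pow_succ, ← ih, pow_add, Units.val_mul, Int.cast_mul]
    linear_combination (((Perm.sign (Perm.ofSubtype
      (g.subtypePerm (apply_mem_orbUnion g T))) : ℤ) : ℚ) * (-1) ^ (orbUnion g T).card) * hsign

theorem signOn_orbUnion (g : Perm α) (T : Finset (Orb g)) :
    signOn g (orbUnion g T) * (-1) ^ (orbUnion g T).card = (-1) ^ T.card := by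
  rw [← sign_restrict_orbUnion, Perm.sign_ofSubtype, signOn, dif_pos (apply_mem_orbUnion g T)]

omit [DecidableEq α] in
theorem card_orbUnion (g : Perm α) (T : Finset (Orb g)) :
    (orbUnion g T).card = ∑ ω ∈ T, (orbUnion g {ω}).card := by
  rw [Finset.card_eq_sum_card_fiberwise (f := toOrb g) (t := T)
    (fun x hx => mem_orbUnion.1 hx)]
  refine Finset.sum_congr rfl fun ω hω => congrArg Finset.card ?_
  ext x
  simp only [Finset.mem_filter, mem_orbUnion, Finset.mem_singleton]
  exact ⟨fun h => h.2, fun h => ⟨h ▸ hω, h⟩⟩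

/-- Both sides are `det(1 - X g)`. Only invariant subsets contribute on the left; they are the
unions of orbits, and these index the terms of the expanded product. -/
theorem sum_signOn (g : Perm α) :
    ∑ S : Finset α, Polynomial.C (signOn g S * (-1) ^ S.card) * Polynomial.X ^ S.card =
      ∏ ω : Orb g, (1 - Polynomial.X ^ (orbUnion g {ω}).card : Polynomial ℚ) := by
  have h1 : ∀ ω : Orb g, (1 - Polynomial.X ^ (orbUnion g {ω}).card : Polynomial ℚ) =
      1 + -Polynomial.X ^ (orbUnion g {ω}).card := fun ω => sub_eq_add_neg _ _
  simp only [h1]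
  rw [Finset.prod_one_add, Finset.powerset_univ]
  symm
  refine Finset.sum_of_injOn (orbUnion g) (orbUnion_injective g).injOn (fun _ _ => by simp) ?_ ?_
  · intro S _ hS
    rw [signOn, dif_neg, zero_mul, map_zero, zero_mul]
    intro h
    obtain ⟨T, hT⟩ := exists_orbUnion_eq h
    exact hS ⟨T, by simp, hT⟩
  · intro T _
    rw [signOn_orbUnion, card_orbUnion, Finset.prod_neg, Finset.prod_pow_eq_pow_sum]
    simp

theorem prod_orb_eq {R : Type*} [CommMonoid R] (g : Perm α) (f : ℕ → R) :
    ∏ ω : Orb g, f (orbUnion g {ω}).card = (g.partition.parts.map f).prod := by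
  rw [Perm.parts_partition, Multiset.map_add, Multiset.prod_add, Multiset.map_replicate,
    Multiset.prod_replicate, Perm.cycleType_def, Multiset.map_map,
    ← Finset.prod_filter_mul_prod_filter_not Finset.univ
      (fun ω : Orb g => ∃ x, toOrb g x = ω ∧ g x ≠ x)]
  congr 1
  · symm
    rw [← Finset.prod_eq_multiset_prod]
    have hx : ∀ c ∈ g.cycleFactorsFinset, ∃ x, g.cycleOf x = c ∧ g x ≠ x := by
      intro c hc
      obtain ⟨hcyc, hcg⟩ := Perm.mem_cycleFactorsFinset_iff.1 hc
      obtain ⟨x, hx, -⟩ := hcyc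
      refine ⟨x, ?_, ?_⟩
      · exact ((Perm.cycle_is_cycleOf (Perm.mem_support.2 hx) hc)).symm
      · rw [← hcg x (Perm.mem_support.2 hx)]; exact hx
    choose X hX using hx
    refine Finset.prod_bij (fun c hc => toOrb g (X c hc)) ?_ ?_ ?_ ?_
    · intro c hc
      exact Finset.mem_filter.2 ⟨Finset.mem_univ _, X c hc, rfl, (hX c hc).2⟩
    · intro c hc c' hc' h
      rw [← (hX c hc).1, ← (hX c' hc').1]
      exact Perm.SameCycle.cycleOf_eq (toOrb_eq_iff.1 h)
    · intro ω hω
      obtain ⟨-, x, rfl, hx⟩ := Finset.mem_filter.1 hω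
      have hc := Perm.cycleOf_mem_cycleFactorsFinset_iff.2 (Perm.mem_support.2 hx)
      refine ⟨g.cycleOf x, hc, ?_⟩
      obtain ⟨h1, h2⟩ := hX _ hc
      rw [toOrb_eq_iff, ← Perm.mem_support_cycleOf_iff' h2, h1, Perm.mem_support_cycleOf_iff' hx]
    · intro c hc
      rw [orbUnion_singleton_of_not_fixed (hX c hc).2, (hX c hc).1]
      rfl
  · rw [← Finset.card_compl, ← Finset.prod_const]
    symm
    refine Finset.prod_bij (fun x _ => toOrb g x) ?_ ?_ ?_ ?_
    · intro x hx
      have hx' : g x = x := by simpa using hx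
      refine Finset.mem_filter.2 ⟨Finset.mem_univ _, ?_⟩
      rintro ⟨y, hyx, hy⟩
      have := Perm.SameCycle.eq_of_right (toOrb_eq_iff.1 hyx) hx'
      exact hy (this ▸ hx')
    · intro x hx y hy h
      have hx' : g x = x := by simpa using hx
      exact Perm.SameCycle.eq_of_left (toOrb_eq_iff.1 h) hx'
    · intro ω hω
      obtain ⟨x, rfl⟩ := toOrb_surjective g ω
      refine ⟨x, ?_, rfl⟩
      have := (Finset.mem_filter.1 hω).2
      push Not at this
      simpa using this x rfl
    · intro x hx
      have hx' : g x = x := by simpa using hx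
      rw [orbUnion_singleton_of_fixed hx', Finset.card_singleton]

/-- The alternating characters of the exterior powers of the permutation representation are
the coefficients of the characteristic polynomial. -/
theorem idealChar_exterior_eq_coeff (g : Perm α) (S : Finset α) :
    (-1) ^ S.card * idealChar (Ideal.span {symSum Sᶜ * altSum S}) g =
      ((g.partition.parts.map fun k => (1 - Polynomial.X ^ k : Polynomial ℚ)).prod).coeff
        S.card := by
  have hp : g⁻¹.partition.parts = g.partition.parts := by
    rw [Perm.parts_partition, Perm.parts_partition, Perm.cycleType_inv, Perm.support_inv]
  rw [← hp, ← prod_orb_eq, ← sum_signOn, idealChar_exterior, Polynomial.finsetSum_coeff,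
    Finset.mul_sum, ← Finset.powerset_univ, Finset.powersetCard_eq_filter, Finset.sum_filter]
  refine Finset.sum_congr rfl fun S' _ => ?_
  rw [Polynomial.coeff_C_mul, Polynomial.coeff_X_pow]
  by_cases h : S'.card = S.card
  · rw [if_pos h, if_pos h.symm, mul_one, h, mul_comm]
  · rw [if_neg h, if_neg (fun h' => h h'.symm), mul_zero]

/-- The value of a hook character. -/
theorem idealChar_hook (g : Perm α) (Q : Polynomial ℚ)
    (hQ : (1 - Polynomial.X) * Q =
      (g.partition.parts.map fun k => (1 - Polynomial.X ^ k : Polynomial ℚ)).prod)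
    (k : ℕ) (S : Finset α) (hS : S.card = k) (x : α) (hx : x ∉ S) :
    (-1) ^ k * idealChar (Ideal.span {symSum Sᶜ * altSum (insert x S)}) g = Q.coeff k := by
  induction k generalizing S x with
  | zero =>
    obtain rfl := Finset.card_eq_zero.1 hS
    have h1 := idealChar_exterior_eq_coeff g ∅
    have h2 : altSum (insert x (∅ : Finset α)) = altSum ∅ := by
      rw [altSum_insert (Finset.notMem_empty x)]
      simp
    rw [h2]
    rw [Finset.card_empty] at h1
    rw [h1, ← hQ, Polynomial.mul_coeff_zero]
    simp
  | succ k ih =>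
    obtain ⟨s, hs⟩ := Finset.card_pos.1 (by omega : 0 < S.card)
    have h1 := idealChar_exterior_eq_coeff g S
    -- The exterior power of degree `k + 1` is the sum of the hooks of legs `k` and `k + 1`. The
    -- hook of leg `k` appears with `s` as corner and `S.erase s` as leg, and the coefficients of
    -- `(1 - X) Q` obey the same recursion.
    rw [idealChar_symSum_mul_altSum disjoint_compl_left (Finset.mem_compl.2 hx) hs] at h1
    have h2 := ih (S.erase s) (by rw [Finset.card_erase_of_mem hs, hS]; rfl) s
      (Finset.notMem_erase s S)
    rw [Finset.insert_erase hs, Finset.compl_erase] at h2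
    rw [hS, ← hQ, sub_mul, one_mul, Polynomial.coeff_sub, Polynomial.coeff_X_mul, ← h2] at h1
    rw [pow_succ] at h1 ⊢
    linear_combination h1

end Orbits

/-! ### Hooks -/

section Hooks

open Equiv

variable {d : ℕ}

/-- The hook `(d - k, 1, …, 1)` with leg length `k`. -/
def hook (d k : ℕ) (hk : k < d) : Nat.Partition d where
  parts := (d - k) ::ₘ Multiset.replicate k 1
  parts_pos := by
    intro i hi
    rcases Multiset.mem_cons.1 hi with rfl | hi
    · omega
    · rw [Multiset.eq_of_mem_replicate hi]; exact one_pos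
  parts_sum := by simp; omega

theorem partList_hook (k : ℕ) (hk : k < d) :
    partList (hook d k hk) = (d - k) :: List.replicate k 1 := by
  refine List.Perm.eq_of_sortedGE (partList_sorted _) ?_ ?_
  · refine List.Pairwise.sortedGE (List.pairwise_cons.2 ?_)
    refine ⟨fun b hb => ?_, List.pairwise_replicate.2 (Or.inr le_rfl)⟩
    rw [List.eq_of_mem_replicate hb]
    omega
  · rw [← Multiset.coe_eq_coe, partList_coe]
    rfl

/-- The rows of length one telescope: for such a row the first cube is the subtracted cube of the
row above. Only the first row and the last subtracted cube survive. -/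
theorem shiftedPowerSum_hook (k : ℕ) (hk : k < d) :
    shiftedPowerSum 3 (hook d k hk) = ((d : ℚ) - k - 1 / 2) ^ 3 + ((k : ℚ) + 1 / 2) ^ 3 := by
  have h1 : ∀ w : List ℕ, (∑ i : Fin w.length, (((w.get i : ℚ) - ((i : ℕ) + 1) + 1 / 2) ^ 3 -
      (-((i : ℕ) + 1 : ℚ) + 1 / 2) ^ 3)) =
      ∑ i ∈ Finset.range w.length, (((w.getD i 0 : ℕ) : ℚ) - ((i : ℕ) + 1) + 1 / 2) ^ 3 -
        ∑ i ∈ Finset.range w.length, (-((i : ℕ) + 1 : ℚ) + 1 / 2) ^ 3 := by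
    intro w
    rw [← Finset.sum_sub_distrib, Finset.sum_range]
    simp
  rw [shiftedPowerSum, h1, partList_hook, List.length_cons, List.length_replicate,
    Finset.sum_range_succ']
  have h2 : ∀ i ∈ Finset.range k,
      (((((d - k) :: List.replicate k 1).getD (i + 1) 0 : ℕ) : ℚ) - ((i + 1 : ℕ) + 1) + 1 / 2) ^ 3 =
        (-(i + 1 : ℚ) + 1 / 2) ^ 3 := by
    intro i hi
    have : ((d - k) :: List.replicate k 1).getD (i + 1) 0 = 1 := by
      simp [Finset.mem_range.1 hi]
    rw [this]
    push_cast
    ring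
  rw [Finset.sum_congr rfl h2, Finset.sum_range_succ]
  simp only [List.getD_cons_zero, Nat.cast_sub hk.le]
  push_cast
  ring

theorem mem_diagram {μ : Nat.Partition d} {c : ℕ × ℕ} :
    c ∈ (diagram μ).cells ↔ ∃ h : c.1 < (partList μ).length, c.2 < (partList μ)[c.1] := by
  rw [YoungDiagram.mem_cells, diagram, YoungDiagram.mem_ofRowLens]

theorem tableau_fst_lt (μ : Nat.Partition d) (i : Fin d) : (tableau μ i).1.1 < len μ := by
  obtain ⟨h, -⟩ := mem_diagram.1 (tableau μ i).2
  rw [len, ← partList_coe]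
  exact h

theorem tableau_snd_lt (μ : Nat.Partition d) (i : Fin d) :
    (tableau μ i).1.2 < (partList μ).headD 0 := by
  obtain ⟨h, h2⟩ := mem_diagram.1 (tableau μ i).2
  refine h2.trans_le ?_
  have hs := partList_sorted μ
  revert h h2 hs
  generalize (tableau μ i).1 = c
  generalize partList μ = w
  intro h _ hs
  cases w with
  | nil => simp at h
  | cons a w =>
    have h3 := List.pairwise_cons.1 hs.pairwise
    rcases List.mem_cons.1 (List.getElem_mem h) with h4 | h4
    · rw [h4]; rfl
    · exact h3.1 _ h4

/-- A partition whose first part and length are large enough is a hook. -/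
theorem eq_hook_of_le (μ : Nat.Partition d) (k : ℕ) (hk : k < d)
    (h1 : d - k ≤ (partList μ).headD 0) (h2 : k + 1 ≤ len μ) : μ = hook d k hk := by
  have hsum : (partList μ).sum = d := by
    rw [← Multiset.sum_coe, partList_coe, μ.parts_sum]
  have hpos := partList_pos μ
  have hlen : len μ = (partList μ).length := by rw [len, ← partList_coe]; rfl
  apply Nat.Partition.ext
  rw [← partList_coe μ]
  rw [hlen] at h2
  revert hsum hpos h1 h2
  generalize partList μ = w
  intro h1 h2 hsum hpos
  cases w with
  | nil => simp at h2
  | cons a w =>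
    simp only [List.headD_cons, List.length_cons, List.sum_cons, List.mem_cons] at *
    have hle : w.length ≤ w.sum := List.length_le_sum_of_one_le w fun i hi => hpos i (Or.inr hi)
    have hw : w = List.replicate k 1 := by
      have hl : w.length = k := by omega
      have hsw : w.sum = w.length := by omega
      rw [List.eq_replicate_iff]
      refine ⟨hl, fun b hb => ?_⟩
      obtain ⟨u, v, rfl⟩ := List.append_of_mem hb
      have hu : u.length ≤ u.sum := List.length_le_sum_of_one_le u fun i hi =>
        hpos i (Or.inr (by simp [hi]))
      have hv : v.length ≤ v.sum := List.length_le_sum_of_one_le v fun i hi =>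
        hpos i (Or.inr (by simp [hi]))
      have hb1 := hpos b (Or.inr hb)
      simp only [List.sum_append, List.sum_cons, List.length_append, List.length_cons] at hsw
      omega
    have ha : a = d - k := by
      rw [hw] at hsum
      simp at hsum
      omega
    rw [hw, ha]
    rfl

/-- The sum over the row group. -/
def rowSum (μ : Nat.Partition d) : MonoidAlgebra ℚ (Perm (Fin d)) :=
  ∑ p ∈ rowPerms μ, MonoidAlgebra.of ℚ _ p

/-- The signed sum over the column group. -/
def colSum (μ : Nat.Partition d) : MonoidAlgebra ℚ (Perm (Fin d)) :=
  ∑ q ∈ colPerms μ, ((Perm.sign q : ℤ) : ℚ) • MonoidAlgebra.of ℚ _ q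

theorem youngSymmetrizer_eq (μ : Nat.Partition d) : youngSymmetrizer μ = rowSum μ * colSum μ := rfl

theorem swap_tableau {β : Type*} (f : Fin d → β) {i j : Fin d} (h : f i = f j) (k : Fin d) :
    f (swap i j k) = f k := by
  rcases eq_or_ne k i with rfl | hi
  · rw [swap_apply_left, h]
  · rcases eq_or_ne k j with rfl | hj
    · rw [swap_apply_right, h]
    · rw [swap_apply_of_ne_of_ne hi hj]

theorem rowSum_mul_swap (μ : Nat.Partition d) {i j : Fin d}
    (h : (tableau μ i).1.1 = (tableau μ j).1.1) :
    rowSum μ * MonoidAlgebra.of ℚ _ (swap i j) = rowSum μ := by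
  have hs : ∀ p ∈ rowPerms μ, p * swap i j ∈ rowPerms μ := by
    intro p hp
    simp only [rowPerms, Finset.mem_filter, Finset.mem_univ, true_and] at hp ⊢
    intro k
    rw [Perm.mul_apply, hp]
    exact swap_tableau (fun i => (tableau μ i).1.1) h k
  rw [rowSum, Finset.sum_mul]
  refine Finset.sum_bij' (fun p _ => p * swap i j) (fun p _ => p * swap i j) hs hs
    (fun p _ => by simp [mul_assoc]) (fun p _ => by simp [mul_assoc]) fun p _ => by
      rw [map_mul]

theorem colSum_mul_swap (μ : Nat.Partition d) {i j : Fin d} (hij : i ≠ j)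
    (h : (tableau μ i).1.2 = (tableau μ j).1.2) :
    colSum μ * MonoidAlgebra.of ℚ _ (swap i j) = -colSum μ := by
  have hs : ∀ p ∈ colPerms μ, p * swap i j ∈ colPerms μ := by
    intro p hp
    simp only [colPerms, Finset.mem_filter, Finset.mem_univ, true_and] at hp ⊢
    intro k
    rw [Perm.mul_apply, hp]
    exact swap_tableau (fun i => (tableau μ i).1.2) h k
  rw [colSum, Finset.sum_mul, ← Finset.sum_neg_distrib]
  refine Finset.sum_bij' (fun p _ => p * swap i j) (fun p _ => p * swap i j) hs hs
    (fun p _ => by simp [mul_assoc]) (fun p _ => by simp [mul_assoc]) fun p _ => by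
      rw [Perm.sign_mul, Perm.sign_swap hij, smul_mul_assoc, map_mul]
      simp

/-- By the pigeonhole principle, any translate of `A` has two points in one column, and their
transposition is absorbed by the symmetrizer but negates the column sum. The next lemma is the same
argument for rows. -/
theorem colSum_mul_symSum (μ : Nat.Partition d) (A : Finset (Fin d))
    (hA : (partList μ).headD 0 < A.card) (x : MonoidAlgebra ℚ (Perm (Fin d))) :
    colSum μ * x * symSum A = 0 := by
  induction x using MonoidAlgebra.induction_on with
  | add a b ha hb => rw [mul_add, add_mul, ha, hb, add_zero]
  | smul r a ha => rw [mul_smul_comm, smul_mul_assoc, ha, smul_zero]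
  | of g =>
    rw [mul_assoc, symSum, of_mul_charSum_eq, ← mul_assoc]
    obtain ⟨i, hi, j, hj, hij, h⟩ := Finset.exists_ne_map_eq_of_card_lt_of_maps_to
      (s := A.map g.toEmbedding) (t := Finset.range ((partList μ).headD 0))
      (f := fun i => (tableau μ i).1.2) (by simpa using hA)
      (fun i _ => Finset.mem_coe.2 (Finset.mem_range.2 (tableau_snd_lt μ i)))
    have h1 := of_mul_charSum 1 _ (swap_mem_permsOn hi hj)
    simp only [MonoidHom.one_apply, Units.val_one, Int.cast_one, one_smul] at h1
    have h2 : colSum μ * charSum 1 (A.map g.toEmbedding) =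
        -(colSum μ * charSum 1 (A.map g.toEmbedding)) := by
      conv_lhs => rw [← h1, ← mul_assoc, colSum_mul_swap μ hij h, neg_mul]
    rw [eq_zero_of_eq_neg h2, zero_mul]

theorem rowSum_mul_altSum (μ : Nat.Partition d) (B : Finset (Fin d))
    (hB : len μ < B.card) (x : MonoidAlgebra ℚ (Perm (Fin d))) :
    rowSum μ * x * altSum B = 0 := by
  induction x using MonoidAlgebra.induction_on with
  | add a b ha hb => rw [mul_add, add_mul, ha, hb, add_zero]
  | smul r a ha => rw [mul_smul_comm, smul_mul_assoc, ha, smul_zero]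
  | of g =>
    rw [mul_assoc, altSum, of_mul_charSum_eq, ← mul_assoc]
    obtain ⟨i, hi, j, hj, hij, h⟩ := Finset.exists_ne_map_eq_of_card_lt_of_maps_to
      (s := B.map g.toEmbedding) (t := Finset.range (len μ))
      (f := fun i => (tableau μ i).1.1) (by simpa using hB)
      (fun i _ => Finset.mem_coe.2 (Finset.mem_range.2 (tableau_fst_lt μ i)))
    have h1 := of_mul_charSum Perm.sign _ (swap_mem_permsOn hi hj)
    rw [Perm.sign_swap hij] at h1
    simp only [Units.val_one, Int.cast_one, one_smul, Units.val_neg, Int.cast_neg, neg_smul] at h1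
    have h2 : rowSum μ * charSum Perm.sign (B.map g.toEmbedding) =
        -(rowSum μ * charSum Perm.sign (B.map g.toEmbedding)) := by
      conv_lhs => rw [← rowSum_mul_swap μ h, mul_assoc, h1, mul_neg]
    rw [eq_zero_of_eq_neg h2, zero_mul]

/-- The Young symmetrizer of a hook. -/
theorem exists_youngSymmetrizer_hook (k : ℕ) (hk : k < d) :
    ∃ (S : Finset (Fin d)) (x : Fin d), S.card = k ∧ x ∉ S ∧
      youngSymmetrizer (hook d k hk) = symSum Sᶜ * altSum (insert x S) := by
  set μ := hook d k hk with hμ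
  have hcell : ∀ c : ℕ × ℕ, c ∈ (diagram μ).cells ↔
      (c.1 = 0 ∧ c.2 < d - k) ∨ (c.2 = 0 ∧ 0 < c.1 ∧ c.1 ≤ k) := by
    rintro ⟨i, j⟩
    rw [mem_diagram]
    have hp := partList_hook k hk
    rw [← hμ] at hp
    simp only [hp, List.length_cons, List.length_replicate]
    cases i with
    | zero => simp
    | succ i =>
      simp only [List.getElem_cons_succ, List.getElem_replicate]
      constructor
      · rintro ⟨h1, h2⟩; omega
      · intro h; exact ⟨by omega, by omega⟩
  have h00 : ((0, 0) : ℕ × ℕ) ∈ (diagram μ).cells := (hcell _).2 (Or.inl ⟨rfl, by simp; omega⟩)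
  let x : Fin d := (tableau μ).symm ⟨(0, 0), h00⟩
  have hx : tableau μ x = ⟨(0, 0), h00⟩ := (tableau μ).apply_symm_apply _
  -- The leg without the corner `x`. All rows but the first are singletons, so the row group is that
  -- of the complement of `S`; the first column is `insert x S`.
  let S : Finset (Fin d) := {i | (tableau μ i).1.1 ≠ 0}
  have hmemS : ∀ i, i ∈ S ↔ (tableau μ i).1.1 ≠ 0 := fun i => by simp [S]
  have hinj : ∀ i j, (tableau μ i).1 = (tableau μ j).1 → i = j := fun i j h =>
    (tableau μ).injective (Subtype.ext h)
  have hxS : x ∉ S := by rw [hmemS, hx]; simp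
  refine ⟨S, x, ?_, hxS, ?_⟩
  · rw [← Nat.card_Icc 1 k |>.trans (by omega : k + 1 - 1 = k)]
    refine Finset.card_bij (fun i _ => (tableau μ i).1.1) ?_ ?_ ?_
    · intro i hi
      rw [hmemS] at hi
      have := (hcell _).1 (tableau μ i).2
      rw [Finset.mem_Icc]
      omega
    · intro i hi j hj h
      rw [hmemS] at hi hj
      have h1 := (hcell _).1 (tableau μ i).2
      have h2 := (hcell _).1 (tableau μ j).2
      exact hinj i j (Prod.ext h (by omega))
    · intro b hb
      rw [Finset.mem_Icc] at hb
      have hc : ((b, 0) : ℕ × ℕ) ∈ (diagram μ).cells := (hcell _).2 (Or.inr ⟨rfl, by simp; omega⟩)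
      have hc' : tableau μ ((tableau μ).symm ⟨(b, 0), hc⟩) = ⟨(b, 0), hc⟩ :=
        (tableau μ).apply_symm_apply _
      refine ⟨(tableau μ).symm ⟨(b, 0), hc⟩, ?_, ?_⟩
      · rw [hmemS, hc']; simp; omega
      · rw [hc']
  · have hrow : rowPerms μ = permsOn Sᶜ := by
      ext σ
      simp only [rowPerms, Finset.mem_filter, Finset.mem_univ, true_and, mem_permsOn,
        Finset.mem_compl, not_not]
      constructor
      · intro h i hi
        rw [hmemS] at hi
        have h1 := (hcell _).1 (tableau μ i).2
        have h2 := (hcell _).1 (tableau μ (σ i)).2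
        have h3 := h i
        exact hinj _ _ (Prod.ext h3 (by omega))
      · intro h i
        by_cases hi : i ∈ S
        · rw [h i hi]
        · have hi' : σ i ∉ S := fun h' => hi (by rwa [σ.injective (h _ h')] at h')
          rw [hmemS, not_not] at hi hi'
          rw [hi, hi']
    have hB : ∀ i, i ∈ insert x S ↔ (tableau μ i).1.2 = 0 := by
      intro i
      rw [Finset.mem_insert, hmemS]
      have h1 := (hcell _).1 (tableau μ i).2
      constructor
      · rintro (rfl | h)
        · rw [hx]
        · omega
      · intro h
        by_cases h0 : (tableau μ i).1.1 = 0
        · exact Or.inl (hinj _ _ (by rw [hx]; exact Prod.ext h0 h))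
        · exact Or.inr h0
    have hcol : colPerms μ = permsOn (insert x S) := by
      ext σ
      simp only [colPerms, Finset.mem_filter, Finset.mem_univ, true_and, mem_permsOn]
      constructor
      · intro h i hi
        rw [hB] at hi
        have h1 := (hcell _).1 (tableau μ i).2
        have h2 := (hcell _).1 (tableau μ (σ i)).2
        have h3 := h i
        exact hinj _ _ (Prod.ext (by omega) h3)
      · intro h i
        by_cases hi : i ∈ insert x S
        · have hi' : σ i ∈ insert x S := by
            by_contra h'
            exact h' (by rwa [σ.injective (h _ h')])
          rw [hB] at hi hi'
          rw [hi, hi']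
        · rw [h i hi]
    rw [youngSymmetrizer_eq, rowSum, colSum, hrow, hcol]
    simp [charSum]

/-- If `μ` is not this hook, its first row is shorter than `d - k` or it has fewer than `k + 1`
rows, and one of the two pigeonhole lemmas applies. -/
theorem youngSymmetrizer_mul_hook (μ : Nat.Partition d) (k : ℕ) (hk : k < d)
    (h : μ ≠ hook d k hk) (x : MonoidAlgebra ℚ (Perm (Fin d))) :
    youngSymmetrizer μ * x * youngSymmetrizer (hook d k hk) = 0 := by
  obtain ⟨S, y, hS, hy, hc⟩ := exists_youngSymmetrizer_hook k hk
  rw [hc, youngSymmetrizer_eq]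
  by_cases h1 : d - k ≤ (partList μ).headD 0
  · have h2 : len μ < (insert y S).card := by
      rw [Finset.card_insert_of_notMem hy, hS]
      by_contra h2
      exact h (eq_hook_of_le μ k hk h1 (by omega))
    have := rowSum_mul_altSum μ _ h2 (colSum μ * x * symSum Sᶜ)
    simpa only [mul_assoc] using this
  · have h2 : (partList μ).headD 0 < Sᶜ.card := by
      rw [Finset.card_compl, Fintype.card_fin, hS]
      omega
    have := colSum_mul_symSum μ _ h2 x
    rw [mul_assoc (rowSum μ), mul_assoc (rowSum μ), ← mul_assoc (colSum μ * x), this, zero_mul,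
      mul_zero]

end Hooks

/-! ### Reduction of the character sum to hooks -/

section HookSum

open Equiv

variable {d : ℕ}

/-- The product `∏ (1 - X^k)` over the elements `k` of a multiset. -/
def oneSubPowProd (m : Multiset ℕ) : Polynomial ℚ :=
  (m.map fun k => (1 - Polynomial.X ^ k : Polynomial ℚ)).prod

/-- One factor is divided by `1 - X`, leaving a geometric sum with value `a` at `1`; any further
factor vanishes there. The value at `1` is what detects full cycles. -/
theorem exists_oneSubPowProd_eq (m : Multiset ℕ) (hm : m ≠ 0) :
    ∃ Q : Polynomial ℚ, (1 - Polynomial.X) * Q = oneSubPowProd m ∧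
      Q.eval 1 = if Multiset.card m = 1 then (m.sum : ℚ) else 0 := by
  obtain ⟨a, ha⟩ := Multiset.exists_mem_of_ne_zero hm
  obtain ⟨t, rfl⟩ := Multiset.exists_cons_of_mem ha
  refine ⟨(∑ i ∈ Finset.range a, Polynomial.X ^ i) * oneSubPowProd t, ?_, ?_⟩
  · rw [← mul_assoc, mul_neg_geom_sum, oneSubPowProd, oneSubPowProd, Multiset.map_cons,
      Multiset.prod_cons]
  · rw [Multiset.card_cons, Multiset.sum_cons, Polynomial.eval_mul, Polynomial.eval_finsetSum]
    rcases Multiset.empty_or_exists_mem t with rfl | ⟨b, hb⟩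
    · simp [oneSubPowProd]
    · obtain ⟨u, rfl⟩ := Multiset.exists_cons_of_mem hb
      simp [oneSubPowProd]

theorem natDegree_lt_of_mul_eq {m : Multiset ℕ} {Q : Polynomial ℚ}
    (hQ : (1 - Polynomial.X) * Q = oneSubPowProd m) (hm : 0 < m.sum) : Q.natDegree < m.sum := by
  by_cases h0 : Q = 0
  · simpa [h0] using hm
  have h1 : (1 - Polynomial.X : Polynomial ℚ).natDegree = 1 := by
    rw [← neg_sub, Polynomial.natDegree_neg]
    exact Polynomial.natDegree_X_sub_C 1
  have h1' : (1 - Polynomial.X : Polynomial ℚ) ≠ 0 := fun h => by simp [h] at h1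
  have h2 := Polynomial.natDegree_mul h1' h0
  have h3 : (oneSubPowProd m).natDegree ≤ m.sum := by
    refine (Polynomial.natDegree_multiset_prod_le _).trans ?_
    rw [Multiset.map_map]
    calc _ ≤ (m.map id).sum := Multiset.sum_map_le_sum_map _ _ fun k _ => by
          refine (Polynomial.natDegree_sub_le _ _).trans ?_
          simp
      _ = m.sum := by rw [Multiset.map_id]
  rw [hQ, h1] at h2
  omega

theorem irrChar_eq_idealChar (μ ν : Nat.Partition d) (σ : Perm (Fin d))
    (hσ : σ.partition.parts = ν.parts) :
    irrChar μ ν = idealChar (Ideal.span {youngSymmetrizer μ}) σ := irrChar_eq μ ν σ hσ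

theorem idealChar_youngSymmetrizer_hook (k : ℕ) (hk : k < d) (σ : Perm (Fin d))
    {Q : Polynomial ℚ} (hQ : (1 - Polynomial.X) * Q = oneSubPowProd σ.partition.parts) :
    (-1) ^ k * idealChar (Ideal.span {youngSymmetrizer (hook d k hk)}) σ = Q.coeff k := by
  obtain ⟨S, y, hS, hy, hc⟩ := exists_youngSymmetrizer_hook k hk
  rw [hc, idealChar_hook σ Q hQ k S hS y hy]

theorem irrChar_hook (k : ℕ) (hk : k < d) (ν : Nat.Partition d) {Q : Polynomial ℚ}
    (hQ : (1 - Polynomial.X) * Q = oneSubPowProd ν.parts) :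
    irrChar (hook d k hk) ν = (-1) ^ k * Q.coeff k := by
  obtain ⟨σ, hσ⟩ := exists_perm_parts ν
  rw [irrChar_eq_idealChar _ ν σ hσ,
    ← idealChar_youngSymmetrizer_hook k hk σ (by rw [hσ, hQ]), ← mul_assoc, ← mul_pow]
  simp

theorem irrChar_hook_indiscrete (k : ℕ) (hk : k < d) :
    irrChar (hook d k hk) (Nat.Partition.indiscrete d) = (-1) ^ k := by
  rw [irrChar_hook k hk _ (Q := ∑ i ∈ Finset.range d, Polynomial.X ^ i)]
  · simp [Polynomial.finsetSum_coeff, Polynomial.coeff_X_pow, hk]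
  · rw [mul_neg_geom_sum, Nat.Partition.indiscrete_parts (by omega)]
    simp [oneSubPowProd]

/-- The alternating sum of hook characters at `g` is `Q(1)`, hence `d` on full cycles and `0`
elsewhere. Pairing it with the character of `μ` gives zero by orthogonality, but also `d` times the
number of full cycles times the wanted value. -/
theorem irrChar_indiscrete_eq_zero (hd : 0 < d) (μ : Nat.Partition d)
    (hμ : ∀ k (hk : k < d), μ ≠ hook d k hk) : irrChar μ (Nat.Partition.indiscrete d) = 0 := by
  have hne : ∀ g : Perm (Fin d), g.partition.parts ≠ 0 := by
    intro g h
    have := g.partition.parts_sum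
    rw [h, Fintype.card_fin] at this
    simp at this
    omega
  choose Q hQ hQ1 using fun g : Perm (Fin d) => exists_oneSubPowProd_eq _ (hne g)
  have hsum : ∀ g : Perm (Fin d), ∑ k : Fin d,
      (-1) ^ (k : ℕ) * idealChar (Ideal.span {youngSymmetrizer (hook d k k.2)}) g =
        if Multiset.card g.partition.parts = 1 then (d : ℚ) else 0 := by
    intro g
    have hs : g.partition.parts.sum = d := by rw [g.partition.parts_sum, Fintype.card_fin]
    have h1 := hQ1 g
    rw [hs, Polynomial.eval_eq_sum_range' (n := d), Finset.sum_range] at h1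
    · rw [← h1]
      refine Finset.sum_congr rfl fun k _ => ?_
      rw [idealChar_youngSymmetrizer_hook k k.2 g (hQ g)]
      simp
    · have := natDegree_lt_of_mul_eq (hQ g) (by rw [hs]; exact hd)
      rwa [hs] at this
  have hzero : ∑ g : Perm (Fin d), (if Multiset.card g.partition.parts = 1 then (d : ℚ) else 0) *
      idealChar (Ideal.span {youngSymmetrizer μ}) g⁻¹ = 0 := by
    simp only [← hsum, Finset.sum_mul]
    rw [Finset.sum_comm]
    refine Finset.sum_eq_zero fun k _ => ?_
    simp only [mul_assoc]
    rw [← Finset.mul_sum, sum_idealChar_mul_eq_zero _ _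
      (youngSymmetrizer_mul_hook μ k k.2 (hμ k k.2)), mul_zero]
  have hval : ∀ g : Perm (Fin d), (if Multiset.card g.partition.parts = 1 then (d : ℚ) else 0) *
      idealChar (Ideal.span {youngSymmetrizer μ}) g⁻¹ =
        if Multiset.card g.partition.parts = 1 then
          (d : ℚ) * irrChar μ (Nat.Partition.indiscrete d) else 0 := by
    intro g
    split_ifs with h
    · rw [irrChar_eq_idealChar μ _ g⁻¹]
      rw [Nat.Partition.indiscrete_parts hd.ne', Perm.parts_partition, Perm.cycleType_inv,
        Perm.support_inv, ← Perm.parts_partition]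
      obtain ⟨a, ha⟩ := Multiset.card_eq_one.1 h
      have := g.partition.parts_sum
      rw [ha, Multiset.sum_singleton, Fintype.card_fin] at this
      rw [ha, this]
    · rw [zero_mul]
  rw [Finset.sum_congr rfl fun g _ => hval g, ← Finset.sum_filter, Finset.sum_const,
    nsmul_eq_mul, mul_eq_zero, mul_eq_zero] at hzero
  obtain ⟨σ, hσ⟩ := exists_perm_parts (Nat.Partition.indiscrete d)
  rw [Nat.Partition.indiscrete_parts hd.ne'] at hσ
  have hc : (Finset.univ.filter fun g : Perm (Fin d) =>
      Multiset.card g.partition.parts = 1).card ≠ 0 :=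
    (Finset.card_pos.2 ⟨σ, Finset.mem_filter.2 ⟨Finset.mem_univ _, by rw [hσ]; rfl⟩⟩).ne'
  rcases hzero with h | h | h
  · exact absurd h (Nat.cast_ne_zero.2 hc)
  · exact absurd h (Nat.cast_ne_zero.2 hd.ne')
  · exact h

theorem hook_injective {k l : ℕ} (hk : k < d) (hl : l < d) (h : hook d k hk = hook d l hl) :
    k = l := by
  have := congrArg (fun μ => Multiset.card μ.parts) h
  simpa [hook] using this

/-- Sums over partitions weighted by the character value at a full cycle reduce to hooks. -/
theorem sum_irrChar_indiscrete (hd : 0 < d) (ν : Nat.Partition d) (F : ℚ → ℚ) {Q : Polynomial ℚ}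
    (hQ : (1 - Polynomial.X) * Q = oneSubPowProd ν.parts) :
    ∑ μ : Nat.Partition d, irrChar μ (Nat.Partition.indiscrete d) * F (shiftedPowerSum 3 μ) *
        irrChar μ ν =
      ∑ k ∈ Finset.range d,
        Q.coeff k * F (((d : ℚ) - k - 1 / 2) ^ 3 + ((k : ℚ) + 1 / 2) ^ 3) := by
  rw [Finset.sum_range]
  symm
  refine Finset.sum_of_injOn (fun k : Fin d => hook d k k.2)
    (fun k _ l _ h => Fin.ext (hook_injective k.2 l.2 h)) (fun _ _ => by simp) ?_ ?_
  · intro μ _ hμ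
    rw [irrChar_indiscrete_eq_zero hd μ, zero_mul, zero_mul]
    rintro k hk rfl
    exact hμ ⟨⟨k, hk⟩, by simp, rfl⟩
  · intro k _
    rw [irrChar_hook_indiscrete, irrChar_hook k k.2 ν hQ, shiftedPowerSum_hook]
    have : ((-1 : ℚ) ^ (k : ℕ)) * (-1) ^ (k : ℕ) = 1 := by rw [← mul_pow]; simp
    linear_combination (-(Q.coeff k) *
      F (((d : ℚ) - (k : ℕ) - 1 / 2) ^ 3 + (((k : ℕ) : ℚ) + 1 / 2) ^ 3)) * this

end HookSum

/-! ### The Hurwitz polynomial -/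

section Polynomiality

/-- The power series `exp (c x)`. -/
def expOf (c : ℚ) : PowerSeries ℚ := PowerSeries.rescale c (PowerSeries.exp ℚ)

theorem expOf_add (a b : ℚ) : expOf (a + b) = expOf a * expOf b :=
  (PowerSeries.exp_mul_exp_eq_exp_add a b).symm

theorem expOf_zero : expOf 0 = 1 := by
  rw [expOf, PowerSeries.rescale_zero_apply, PowerSeries.constantCoeff_exp, map_one]

theorem expOf_nat_mul (k : ℕ) (c : ℚ) : expOf (k * c) = expOf c ^ k := by
  induction k with
  | zero => simp [expOf_zero]
  | succ k ih => rw [pow_succ, ← ih, ← expOf_add]; push_cast; ring_nf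

theorem expOf_sum {ι : Type*} (s : Finset ι) (f : ι → ℚ) :
    expOf (∑ i ∈ s, f i) = ∏ i ∈ s, expOf (f i) := by
  classical
  induction s using Finset.induction_on with
  | empty => simp [expOf_zero]
  | insert a s ha ih => rw [Finset.sum_insert ha, Finset.prod_insert ha, expOf_add, ih]

theorem coeff_expOf (c : ℚ) (m : ℕ) : PowerSeries.coeff m (expOf c) = c ^ m / (m ! : ℚ) := by
  rw [expOf, PowerSeries.coeff_rescale, PowerSeries.coeff_exp]
  simp [div_eq_mul_inv]

theorem expOf_sub_expOf_neg (c : ℚ) : expOf c - expOf (-c) =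
    PowerSeries.C (2 * c) * PowerSeries.X * PowerSeries.rescale c sinhDivX := by
  have h := congrArg (fun f => PowerSeries.C (2 : ℚ) * PowerSeries.rescale c f) X_mul_sinhDivX
  simp only [map_mul, map_sub, PowerSeries.rescale_X, PowerSeries.evalNegHom,
    PowerSeries.rescale_rescale] at h
  have h1 : PowerSeries.rescale c (PowerSeries.C (1 / 2 : ℚ)) = PowerSeries.C (1 / 2 : ℚ) := by
    ext m
    rw [PowerSeries.coeff_rescale, PowerSeries.coeff_C]
    split_ifs with hm <;> simp [hm]
  have h2 : (PowerSeries.C (2 : ℚ)) * PowerSeries.C (1 / 2 : ℚ) = 1 := by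
    rw [← map_mul]; norm_num
  rw [h1, ← mul_assoc (PowerSeries.C (2 : ℚ)) (PowerSeries.C (1 / 2 : ℚ)), h2, one_mul] at h
  rw [map_mul, expOf, expOf]
  have h3 : -1 * c = -c := by ring
  rw [h3] at h
  rw [← h]
  ring

theorem constantCoeff_sinhDivX : PowerSeries.constantCoeff sinhDivX = 1 := by
  rw [← PowerSeries.coeff_zero_eq_constantCoeff_apply, sinhDivX, PowerSeries.coeff_mk]
  simp

theorem ofVec_parts_eq_filter {n : ℕ} (a : Fin n → ℕ) :
    (ofVec a).parts = (Finset.univ.val.map a).filter (· ≠ 0) := rfl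

theorem ofVec_parts {n : ℕ} (β : Fin n → ℕ) (hβ : ∀ i, 0 < β i) :
    (ofVec β).parts = Finset.univ.val.map β := by
  rw [ofVec_parts_eq_filter, Multiset.filter_eq_self.2]
  intro a ha
  obtain ⟨i, -, rfl⟩ := Multiset.mem_map.1 ha
  exact (hβ i).ne'

theorem oneSubPowProd_ofVec {n : ℕ} (β : Fin n → ℕ) (hβ : ∀ i, 0 < β i) :
    oneSubPowProd (ofVec β).parts = ∏ i, (1 - Polynomial.X ^ β i) := by
  rw [oneSubPowProd, ofVec_parts β hβ, Multiset.map_map]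
  rfl

/-- Substituting `e^{-2x}` for `X` in `(1 - X) Q = ∏ (1 - X^{β_i})` and multiplying by `e^{dx}`
makes every factor a difference `e^{cx} - e^{-cx}`. One factor `2x` is then cancelled. -/
theorem hookSeries_mul_sinhDivX {n : ℕ} (β : Fin (n + 1) → ℕ) {d : ℕ} (hd : ∑ i, β i = d)
    {Q : Polynomial ℚ} (hQ : (1 - Polynomial.X) * Q = ∏ i, (1 - Polynomial.X ^ β i))
    (hdeg : Q.natDegree < d) :
    (∑ k ∈ Finset.range d, PowerSeries.C (Q.coeff k) * expOf ((d : ℚ) - 1 - 2 * k)) * sinhDivX =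
      PowerSeries.C (2 ^ n * ∏ i, (β i : ℚ)) * PowerSeries.X ^ n *
        ∏ i, PowerSeries.rescale (β i : ℚ) sinhDivX := by
  have h1 : ∑ k ∈ Finset.range d, PowerSeries.C (Q.coeff k) * expOf ((d : ℚ) - 1 - 2 * k) =
      expOf ((d : ℚ) - 1) * Polynomial.aeval (expOf (-2)) Q := by
    rw [Polynomial.aeval_eq_sum_range' hdeg, Finset.mul_sum]
    refine Finset.sum_congr rfl fun k _ => ?_
    have : (d : ℚ) - 1 - 2 * k = (d - 1) + k * (-2) := by ring
    rw [this, expOf_add, expOf_nat_mul, PowerSeries.smul_eq_C_mul]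
    ring
  have h2 : ∀ c : ℚ, expOf c - expOf (-c) = expOf c * (1 - expOf (c * (-2))) := by
    intro c
    rw [mul_sub, mul_one, ← expOf_add]
    congr 2
    ring
  have h3 := congrArg (Polynomial.aeval (expOf (-2))) hQ
  simp only [map_mul, map_prod, map_sub, map_one, map_pow, Polynomial.aeval_X,
    ← expOf_nat_mul] at h3
  have h4 : expOf ((d : ℚ) - 1) * Polynomial.aeval (expOf (-2)) Q * (expOf 1 - expOf (-1)) =
      ∏ i, (expOf (β i) - expOf (-(β i))) := by
    simp only [h2, Finset.prod_mul_distrib]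
    rw [← h3, ← expOf_sum, ← Nat.cast_sum, hd, one_mul]
    have : (d : ℚ) = (d - 1) + 1 := by ring
    conv_rhs => rw [this, expOf_add]
    ring
  rw [← h1] at h4
  simp only [expOf_sub_expOf_neg, Finset.prod_mul_distrib, Finset.prod_const, Finset.card_univ,
    Fintype.card_fin, ← map_prod, PowerSeries.rescale_one, RingHom.id_apply] at h4
  have hne : (PowerSeries.C (2 * 1 : ℚ)) * PowerSeries.X ≠ 0 := by
    refine mul_ne_zero ?_ PowerSeries.X_ne_zero
    rw [Ne, map_eq_zero_iff _ PowerSeries.C_injective]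
    norm_num
  refine mul_left_cancel₀ hne ?_
  calc _ = _ := by ring
    _ = _ := h4
    _ = _ := by
      rw [pow_succ, pow_succ, map_mul PowerSeries.C 2 1, map_mul PowerSeries.C (2 ^ n * 2),
        map_mul PowerSeries.C (2 ^ n) 2, map_mul PowerSeries.C (2 ^ n), map_one]
      ring

/-- The power series `∏ᵢ sinh (xᵢ x) / (xᵢ x)` with polynomial coefficients. -/
def sinhProd (n : ℕ) : PowerSeries (MvPolynomial (Fin n) ℚ) :=
  ∏ i, PowerSeries.rescale (MvPolynomial.X i) (PowerSeries.map MvPolynomial.C sinhDivX)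

/-- The power series `(∏ᵢ sinh (xᵢ x) / (xᵢ x)) / (sinh x / x)`. -/
def sinhQuot (n : ℕ) : PowerSeries (MvPolynomial (Fin n) ℚ) :=
  sinhProd n * PowerSeries.map MvPolynomial.C sinhDivX⁻¹

theorem eval_coeff_sinhQuot {n : ℕ} (x : Fin n → ℚ) (m : ℕ) :
    MvPolynomial.eval x (PowerSeries.coeff m (sinhQuot n)) =
      PowerSeries.coeff m ((∏ i, PowerSeries.rescale (x i) sinhDivX) * sinhDivX⁻¹) := by
  rw [← PowerSeries.coeff_map, sinhQuot, sinhProd, map_mul, map_prod]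
  congr 2
  · refine Finset.prod_congr rfl fun i _ => ?_
    ext k
    simp [PowerSeries.coeff_rescale]
  · ext k
    simp

theorem coeff_hookSeries {n : ℕ} (β : Fin (n + 1) → ℕ) {d : ℕ} (hd : ∑ i, β i = d)
    {Q : Polynomial ℚ} (hQ : (1 - Polynomial.X) * Q = ∏ i, (1 - Polynomial.X ^ β i))
    (hdeg : Q.natDegree < d) (m : ℕ) :
    ∑ k ∈ Finset.range d, Q.coeff k * ((d : ℚ) - 1 - 2 * k) ^ m =
      if n ≤ m then (m ! : ℚ) * 2 ^ n * (∏ i, (β i : ℚ)) *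
        MvPolynomial.eval (fun i => (β i : ℚ)) (PowerSeries.coeff (m - n) (sinhQuot (n + 1)))
      else 0 := by
  have hm : (m ! : ℚ) ≠ 0 := Nat.cast_ne_zero.2 (Nat.factorial_ne_zero m)
  have hinv : sinhDivX * sinhDivX⁻¹ = 1 :=
    PowerSeries.mul_inv_cancel _ (by rw [constantCoeff_sinhDivX]; exact one_ne_zero)
  have h1 := congrArg (fun f => PowerSeries.coeff m (f * sinhDivX⁻¹))
    (hookSeries_mul_sinhDivX β hd hQ hdeg)
  simp only [mul_assoc, hinv, mul_one] at h1
  rw [PowerSeries.coeff_C_mul, PowerSeries.coeff_X_pow_mul', map_sum] at h1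
  simp only [PowerSeries.coeff_C_mul, coeff_expOf] at h1
  rw [eval_coeff_sinhQuot]
  have h2 : ∑ k ∈ Finset.range d, Q.coeff k * ((d : ℚ) - 1 - 2 * k) ^ m =
      (m ! : ℚ) * ∑ k ∈ Finset.range d, Q.coeff k * (((d : ℚ) - 1 - 2 * k) ^ m / (m ! : ℚ)) := by
    rw [Finset.mul_sum]
    refine Finset.sum_congr rfl fun k _ => ?_
    field_simp
  rw [h2, h1]
  split_ifs
  · ring
  · simp

/-- The explicit Hurwitz polynomial in `n = 2 r + 1` variables. -/
def explicitPolynomial (g r : ℕ) : MvPolynomial (Fin (2 * r + 1)) ℚ :=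
  ∑ h ∈ Finset.range (g + 1),
    MvPolynomial.C (((2 * (g + r) - 2 * h)! : ℚ) /
      ((h ! : ℚ) * ((g + r - h)! : ℚ) * 3 ^ h * 2 ^ (g + r + 2 * h) * 4 ^ (g - h))) *
      ((∑ i, MvPolynomial.X i) ^ (g + r + 2 * h) *
        PowerSeries.coeff (2 * g - 2 * h) (sinhQuot (2 * r + 1)))

theorem isHurwitzPolynomial_explicitPolynomial (g r : ℕ) :
    IsHurwitzPolynomial g (2 * r + 1) (explicitPolynomial g r) := by
  intro β hβ
  set d := ∑ i, β i with hd
  have hd0 : 0 < d := lt_of_lt_of_le (hβ 0)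
    (Finset.single_le_sum (f := β) (fun _ _ => Nat.zero_le _) (Finset.mem_univ 0))
  have hne : (ofVec β).parts ≠ 0 := by
    intro h
    have := (ofVec β).parts_sum
    rw [h, Multiset.sum_zero] at this
    omega
  obtain ⟨Q, hQ, -⟩ := exists_oneSubPowProd_eq _ hne
  have hdeg : Q.natDegree < d := by
    have := natDegree_lt_of_mul_eq hQ (by rw [(ofVec β).parts_sum]; exact hd0)
    rwa [(ofVec β).parts_sum] at this
  have hQ' := hQ
  rw [oneSubPowProd_ofVec β hβ] at hQ'
  have hprod : (∏ i, (β i : ℚ)) ≠ 0 :=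
    Finset.prod_ne_zero_iff.2 fun i _ => Nat.cast_ne_zero.2 (hβ i).ne'
  have hparts : (((ofVec β).parts.prod : ℕ) : ℚ) = ∏ i, (β i : ℚ) := by
    rw [ofVec_parts β hβ, Finset.prod_map_val, Nat.cast_prod]
  have hlen : len (ofVec β) = 2 * r + 1 := by
    rw [len, ofVec_parts β hβ]; simp
  have hlen' : len (Nat.Partition.indiscrete d) = 1 := by
    rw [len, Nat.Partition.indiscrete_parts hd0.ne']; rfl
  have hexp : (2 * g + len (Nat.Partition.indiscrete d) + len (ofVec β) - 2) / 2 = g + r := by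
    rw [hlen, hlen']; omega
  have hs : g + (2 * r + 1 - 1) / 2 = g + r := by omega
  rw [doubleHurwitz, hexp, hs]
  have hsum := sum_irrChar_indiscrete hd0 (ofVec β)
    (fun z => (z / ((2 + 1)! : ℚ)) ^ (g + r)) hQ
  rw [show 2 + 1 = 3 from rfl] at hsum ⊢
  rw [hsum, hparts, Nat.Partition.indiscrete_parts hd0.ne', Multiset.prod_singleton]
  have hbinom : ∀ k : ℕ, Q.coeff k *
      ((((d : ℚ) - k - 1 / 2) ^ 3 + ((k : ℚ) + 1 / 2) ^ 3) / (3 ! : ℚ)) ^ (g + r) =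
      ∑ h ∈ Finset.range (g + r + 1), ((d : ℚ) ^ 3 / 24) ^ h * ((d : ℚ) / 8) ^ (g + r - h) *
        ((g + r).choose h : ℚ) * (Q.coeff k * ((d : ℚ) - 1 - 2 * k) ^ (2 * (g + r - h))) := by
    intro k
    -- With `a`, `b` the two cubed numbers, `a + b = d` and `a - b = d - 1 - 2k`, while `4(a^3 +
    -- b^3) = (a + b)((a + b)^2 + 3(a - b)^2)`.
    have h1 : (((d : ℚ) - k - 1 / 2) ^ 3 + ((k : ℚ) + 1 / 2) ^ 3) / (3 ! : ℚ) =
        (d : ℚ) ^ 3 / 24 + (d : ℚ) / 8 * ((d : ℚ) - 1 - 2 * k) ^ 2 := by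
      have : ((3 ! : ℕ) : ℚ) = 6 := by norm_num [Nat.factorial]
      rw [this]
      ring
    rw [h1, add_pow, Finset.mul_sum]
    refine Finset.sum_congr rfl fun h _ => ?_
    rw [mul_pow ((d : ℚ) / 8), pow_mul]
    ring
  simp only [hbinom]
  rw [Finset.sum_comm]
  simp only [← Finset.mul_sum]
  simp only [coeff_hookSeries β hd.symm hQ' hdeg]
  have hsplit : g + r + 1 = (g + 1) + r := by ring
  -- For `h > g` the moment has order `2(g + r - h) < 2r`, below the order of vanishing `n - 1 = 2r`
  -- of the series, so these terms are zero.
  rw [hsplit, Finset.sum_range_add, Finset.sum_eq_zero (s := Finset.range r), add_zero]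
  · rw [explicitPolynomial, map_sum, Finset.mul_sum, Finset.mul_sum, Finset.sum_div]
    refine Finset.sum_congr rfl fun h hh => ?_
    have hhg : h ≤ g := by have := Finset.mem_range.1 hh; omega
    rw [if_pos (by omega)]
    have e1 : 2 * (g + r - h) - 2 * r = 2 * g - 2 * h := by omega
    have e2 : 2 * (g + r - h) = 2 * (g + r) - 2 * h := by omega
    rw [e1, e2]
    simp only [map_mul, MvPolynomial.eval_C, map_pow, map_sum, MvPolynomial.eval_X]
    have hD : (∑ i, (β i : ℚ)) = d := by rw [hd]; push_cast; rfl
    rw [hD]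
    have hch : ((g + r).choose h : ℚ) = ((g + r)! : ℚ) / ((h ! : ℚ) * ((g + r - h)! : ℚ)) :=
      Nat.cast_choose ℚ (by omega)
    rw [hch]
    have hdq : (d : ℚ) ≠ 0 := Nat.cast_ne_zero.2 hd0.ne'
    have f1 : ((g + r)! : ℚ) ≠ 0 := Nat.cast_ne_zero.2 (Nat.factorial_ne_zero _)
    have f2 : (h ! : ℚ) ≠ 0 := Nat.cast_ne_zero.2 (Nat.factorial_ne_zero _)
    have f3 : ((g + r - h)! : ℚ) ≠ 0 := Nat.cast_ne_zero.2 (Nat.factorial_ne_zero _)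
    obtain ⟨u, rfl⟩ := Nat.exists_eq_add_of_le hhg
    have e3 : h + u + r - h = u + r := by omega
    have e4 : h + u - h = u := by omega
    rw [e3] at f3 ⊢
    rw [e4]
    have p1 : (24 : ℚ) ^ h = 3 ^ h * (2 ^ h) ^ 3 := by
      rw [← pow_mul, mul_comm h 3, pow_mul, ← mul_pow]; norm_num
    have p2 : (8 : ℚ) ^ (u + r) = (2 ^ u) ^ 3 * (2 ^ r) ^ 3 := by
      rw [← mul_pow, ← pow_add, ← pow_mul, mul_comm _ 3, pow_mul]; norm_num
    have p3 : (4 : ℚ) ^ u = (2 ^ u) ^ 2 := by rw [← pow_mul, mul_comm, pow_mul]; norm_num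
    rw [div_pow, div_pow, p1, p2, p3]
    field_simp
    ring
  · intro h hh
    have := Finset.mem_range.1 hh
    rw [if_neg (by omega), mul_zero]

end Polynomiality

/-! ### The logarithm of `sinh x / x` -/

section ExpFormula

-- The chain rule for the logarithm. The equation `F' = F (log F)'` is used as a coefficient
-- recursion in place of an explicit exponential.
open PowerSeries in
theorem derivative_sinhDivX :
    derivative ℚ sinhDivX = sinhDivX * derivative ℚ (logOf sinhDivX) := by
  have hs : HasSubst (sinhDivX - 1) := HasSubst.of_constantCoeff_zero' (by
    rw [map_sub, constantCoeff_sinhDivX, map_one, sub_self])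
  have h1 : derivative ℚ (log ℚ) * (1 + X) = 1 := by
    rw [deriv_log]
    ext n
    cases n with
    | zero => simp [mul_add, coeff_one]
    | succ n =>
      rw [mul_add, mul_one, map_add, coeff_succ_mul_X, coeff_mk, coeff_mk, coeff_one]
      simp [pow_succ]
  have h2 := congrArg (fun f => subst (sinhDivX - 1) f) h1
  simp only [subst_mul hs, subst_add hs, subst_X hs] at h2
  have h3 : (1 : PowerSeries ℚ).subst (sinhDivX - 1) = 1 := by
    rw [← coe_substAlgHom hs, map_one]
  rw [h3, add_sub_cancel] at h2
  rw [logOf_eq, derivative_subst hs, ← mul_assoc, mul_comm sinhDivX, h2, one_mul, map_sub]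
  simp

theorem coeff_sinhDivX_succ (k : ℕ) :
    PowerSeries.coeff (k + 1) sinhDivX * ((k : ℚ) + 1) =
      ∑ p ∈ Finset.HasAntidiagonal.antidiagonal k,
        PowerSeries.coeff p.1 sinhDivX * (xi (p.2 + 1) * ((p.2 : ℚ) + 1)) := by
  have h := congrArg (PowerSeries.coeff k) derivative_sinhDivX
  rw [PowerSeries.coeff_mul, PowerSeries.coeff_derivative] at h
  simpa [PowerSeries.coeff_derivative, xi] using h

theorem coeff_sinhDivX_of_odd {m : ℕ} (hm : Odd m) : PowerSeries.coeff m sinhDivX = 0 := by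
  rw [sinhDivX, PowerSeries.coeff_mk, if_neg (Nat.not_even_iff_odd.2 hm)]

/-- Since `sinh x / x` is even, the recursion expresses an odd `ξ` through smaller odd ones, all
zero by induction. -/
theorem xi_of_odd {m : ℕ} (hm : Odd m) : xi m = 0 := by
  induction m using Nat.strong_induction_on with
  | _ m ih =>
    obtain ⟨j, rfl⟩ := hm
    have h := coeff_sinhDivX_succ (2 * j)
    rw [coeff_sinhDivX_of_odd ⟨j, rfl⟩, zero_mul, Finset.sum_eq_single (0, 2 * j)] at h
    · rw [PowerSeries.coeff_zero_eq_constantCoeff_apply, constantCoeff_sinhDivX, one_mul] at h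
      refine (mul_eq_zero.1 h.symm).resolve_right ?_
      positivity
    · rintro ⟨p, q⟩ hpq hne
      rw [Finset.HasAntidiagonal.mem_antidiagonal] at hpq
      dsimp only at hpq ⊢
      rcases Nat.even_or_odd p with hp | hp
      · have hp0 : p ≠ 0 := by
          rintro rfl
          exact hne (by rw [← hpq, zero_add])
        rw [ih (q + 1) (by omega) (by rw [Nat.even_iff] at hp; rw [Nat.odd_iff]; omega), zero_mul,
          mul_zero]
      · rw [coeff_sinhDivX_of_odd hp, zero_mul]
    · intro h0
      exact absurd (Finset.HasAntidiagonal.mem_antidiagonal.2 (zero_add _)) h0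

/-- The logarithm of the product is a sum of rescaled logarithms, so `x_i^q` sums to the power sum
`p_q`. -/
theorem derivative_sinhProd (n : ℕ) :
    PowerSeries.derivative (MvPolynomial (Fin n) ℚ) (sinhProd n) = sinhProd n *
      PowerSeries.mk fun q => MvPolynomial.C (xi (q + 1) * ((q : ℚ) + 1)) *
        MvPolynomial.psum (Fin n) ℚ (q + 1) := by
  have h1 : ∀ i : Fin n, PowerSeries.derivative (MvPolynomial (Fin n) ℚ)
      (PowerSeries.rescale (MvPolynomial.X i) (PowerSeries.map MvPolynomial.C sinhDivX)) =
      PowerSeries.rescale (MvPolynomial.X i) (PowerSeries.map MvPolynomial.C sinhDivX) *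
        PowerSeries.mk fun q => MvPolynomial.C (xi (q + 1) * ((q : ℚ) + 1)) *
          MvPolynomial.X i ^ (q + 1) := by
    intro i
    ext1 k
    rw [PowerSeries.coeff_derivative, PowerSeries.coeff_mul, PowerSeries.coeff_rescale,
      PowerSeries.coeff_map]
    have hk : ((k : MvPolynomial (Fin n) ℚ) + 1) = MvPolynomial.C ((k : ℚ) + 1) := by simp
    rw [hk, mul_assoc, ← map_mul, coeff_sinhDivX_succ, map_sum, Finset.mul_sum]
    refine Finset.sum_congr rfl fun p hp => ?_
    rw [Finset.HasAntidiagonal.mem_antidiagonal] at hp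
    rw [PowerSeries.coeff_rescale, PowerSeries.coeff_map, PowerSeries.coeff_mk, ← hp, map_mul,
      add_assoc, pow_add]
    ring
  have h2 : ∀ s : Finset (Fin n), PowerSeries.derivative (MvPolynomial (Fin n) ℚ)
      (∏ i ∈ s, PowerSeries.rescale (MvPolynomial.X i)
        (PowerSeries.map MvPolynomial.C sinhDivX)) =
      (∏ i ∈ s, PowerSeries.rescale (MvPolynomial.X i)
        (PowerSeries.map MvPolynomial.C sinhDivX)) *
        ∑ i ∈ s, PowerSeries.mk fun q => MvPolynomial.C (xi (q + 1) * ((q : ℚ) + 1)) *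
          (MvPolynomial.X i : MvPolynomial (Fin n) ℚ) ^ (q + 1) := by
    intro s
    induction s using Finset.induction_on with
    | empty => simp
    | insert a s ha ih =>
      rw [Finset.prod_insert ha, Finset.sum_insert ha, Derivation.leibniz, ih, h1, smul_eq_mul,
        smul_eq_mul]
      ring
  rw [sinhProd, h2]
  congr 1
  ext1 q
  simp only [map_sum, PowerSeries.coeff_mk, MvPolynomial.psum, Finset.mul_sum]

theorem coeff_sinhProd_succ (n j : ℕ) :
    ((j : ℚ) + 1) • PowerSeries.coeff (2 * (j + 1)) (sinhProd n) =
      ∑ i ∈ Finset.range (j + 1), ((i : ℚ) + 1) •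
        ((MvPolynomial.C (xi (2 * (i + 1))) * MvPolynomial.psum (Fin n) ℚ (2 * (i + 1))) *
          PowerSeries.coeff (2 * (j - i)) (sinhProd n)) := by
  have h := congrArg (PowerSeries.coeff (2 * j + 1)) (derivative_sinhProd n)
  rw [PowerSeries.coeff_mul, PowerSeries.coeff_derivative] at h
  have h2 : ∑ i ∈ Finset.range (j + 1), (2 : ℚ) • ((i : ℚ) + 1) •
        ((MvPolynomial.C (xi (2 * (i + 1))) * MvPolynomial.psum (Fin n) ℚ (2 * (i + 1))) *
          PowerSeries.coeff (2 * (j - i)) (sinhProd n)) =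
      ∑ p ∈ Finset.HasAntidiagonal.antidiagonal (2 * j + 1), PowerSeries.coeff p.1 (sinhProd n) *
        PowerSeries.coeff p.2 (PowerSeries.mk fun q =>
          MvPolynomial.C (xi (q + 1) * ((q : ℚ) + 1)) *
            MvPolynomial.psum (Fin n) ℚ (q + 1)) := by
    refine Finset.sum_of_injOn (fun i => (2 * (j - i), 2 * i + 1)) ?_ ?_ ?_ ?_
    · intro i _ i' _ h
      have := congrArg Prod.snd h
      dsimp only at this
      omega
    · intro i hi
      have := Finset.mem_range.1 (Finset.mem_coe.1 hi)
      rw [Finset.mem_coe, Finset.HasAntidiagonal.mem_antidiagonal]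
      dsimp only
      omega
    · rintro ⟨p, q⟩ hpq hne
      rw [Finset.HasAntidiagonal.mem_antidiagonal] at hpq
      dsimp only at hpq
      rw [PowerSeries.coeff_mk, xi_of_odd, zero_mul, map_zero, zero_mul, mul_zero]
      by_contra hq
      rw [Nat.not_odd_iff_even, Nat.even_iff] at hq
      refine hne ⟨q / 2, ?_, ?_⟩
      · rw [Finset.mem_coe, Finset.mem_range]; omega
      · exact Prod.ext (by dsimp only; omega) (by dsimp only; omega)
    · intro i _
      rw [PowerSeries.coeff_mk, show 2 * i + 1 + 1 = 2 * (i + 1) by ring, smul_smul,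
        MvPolynomial.smul_eq_C_mul, map_mul MvPolynomial.C (xi _)]
      have : (((2 * i + 1 : ℕ) : ℚ) + 1) = 2 * ((i : ℚ) + 1) := by push_cast; ring
      rw [this]
      ring
  rw [← h2, ← Finset.smul_sum] at h
  have h3 : (2 : ℚ) • ((j : ℚ) + 1) • PowerSeries.coeff (2 * (j + 1)) (sinhProd n) =
      (2 : ℚ) • ∑ i ∈ Finset.range (j + 1), ((i : ℚ) + 1) •
        ((MvPolynomial.C (xi (2 * (i + 1))) * MvPolynomial.psum (Fin n) ℚ (2 * (i + 1))) *
          PowerSeries.coeff (2 * (j - i)) (sinhProd n)) := by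
    rw [← h, smul_smul, MvPolynomial.smul_eq_C_mul, mul_comm]
    rw [show 2 * j + 1 + 1 = 2 * (j + 1) by ring]
    congr 1
    simp only [map_mul, map_add, map_natCast, map_ofNat, map_one]
    push_cast
    ring
  exact smul_right_injective _ (two_ne_zero (α := ℚ)) h3

/-! ### Sums over partitions -/

/-- `∑_{μ ⊢ j} |Aut μ|⁻¹ ∏ t_{μᵢ}`. -/
def partitionSum {A : Type*} [CommRing A] [Algebra ℚ A] (t : ℕ → A) (j : ℕ) : A :=
  ∑ μ : Nat.Partition j, ((autCard μ : ℚ)⁻¹) • (μ.parts.map t).prod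

theorem autCard_eq_prod {d : ℕ} (μ : Nat.Partition d) {s : Finset ℕ} (hs : μ.parts.toFinset ⊆ s) :
    autCard μ = ∏ i ∈ s, (μ.parts.count i)! := by
  refine Finset.prod_subset hs fun i _ hi => ?_
  rw [Multiset.count_eq_zero_of_notMem (fun h => hi (Multiset.mem_toFinset.2 h))]
  rfl

theorem autCard_of_parts_eq_cons {d e i : ℕ} {μ : Nat.Partition d} {ν : Nat.Partition e}
    (h : μ.parts = i ::ₘ ν.parts) : autCard μ = μ.parts.count i * autCard ν := by
  have hs : ν.parts.toFinset ⊆ μ.parts.toFinset := by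
    rw [h, Multiset.toFinset_cons]; exact Finset.subset_insert _ _
  have hi : i ∈ μ.parts.toFinset := by rw [h]; simp
  rw [autCard, autCard_eq_prod ν hs, ← Finset.mul_prod_erase _ _ hi, ← Finset.mul_prod_erase _ _ hi,
    ← mul_assoc]
  congr 1
  · rw [h, Multiset.count_cons_self, Nat.factorial_succ]
  · refine Finset.prod_congr rfl fun k hk => ?_
    rw [h, Multiset.count_cons_of_ne (Finset.ne_of_mem_erase hk)]

/-- Deleting one part `i` matches the partitions of `j` that contain `i` with the partitions of `j -
i`, and divides `|Aut μ|` by the multiplicity of `i`, which the weight compensates. -/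
theorem sum_count_smul {A : Type*} [CommRing A] [Algebra ℚ A] (t : ℕ → A) {j i : ℕ}
    (hi : 0 < i) (hij : i ≤ j) :
    ∑ μ : Nat.Partition j,
      (μ.parts.count i : ℚ) • ((autCard μ : ℚ)⁻¹) • (μ.parts.map t).prod =
        t i * partitionSum t (j - i) := by
  rw [partitionSum, Finset.mul_sum]
  let f : Nat.Partition (j - i) → Nat.Partition j := fun ν =>
    ⟨i ::ₘ ν.parts, fun {k} hk => (Multiset.mem_cons.1 hk).elim (fun h => h ▸ hi) ν.parts_pos, by
      rw [Multiset.sum_cons, ν.parts_sum]; omega⟩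
  symm
  refine Finset.sum_of_injOn f ?_ (fun _ _ => by simp) ?_ ?_
  · intro ν _ ν' _ h
    exact Nat.Partition.ext ((Multiset.cons_inj_right i).1 (congrArg Nat.Partition.parts h))
  · intro μ _ hμ
    rw [Multiset.count_eq_zero_of_notMem, Nat.cast_zero, zero_smul]
    intro hmem
    obtain ⟨u, hu⟩ := Multiset.exists_cons_of_mem hmem
    refine hμ ⟨⟨u, fun {k} hk => μ.parts_pos (hu ▸ Multiset.mem_cons_of_mem hk), ?_⟩, by simp, ?_⟩
    · have := μ.parts_sum
      rw [hu, Multiset.sum_cons] at this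
      omega
    · exact Nat.Partition.ext hu.symm
  · intro ν _
    have h := autCard_of_parts_eq_cons (μ := f ν) (ν := ν) (i := i) rfl
    have hc : ((f ν).parts.count i : ℚ) ≠ 0 :=
      Nat.cast_ne_zero.2 (by change (i ::ₘ ν.parts).count i ≠ 0; simp)
    rw [h, smul_smul, Nat.cast_mul, mul_inv, ← mul_assoc, mul_inv_cancel₀ hc, one_mul]
    change _ = _ • ((i ::ₘ ν.parts).map t).prod
    rw [Multiset.map_cons, Multiset.prod_cons, mul_smul_comm]

/-- Writing the size of `μ` as `∑ i m_i(μ)` and applying the previous lemma to each `i` gives the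
recursion satisfied by the coefficients of `exp(∑ t_i x^i)`. -/
theorem partitionSum_succ {A : Type*} [CommRing A] [Algebra ℚ A] (t : ℕ → A) (j : ℕ) :
    ((j : ℚ) + 1) • partitionSum t (j + 1) =
      ∑ i ∈ Finset.range (j + 1), ((i : ℚ) + 1) • (t (i + 1) * partitionSum t (j - i)) := by
  have h1 : ∀ i ∈ Finset.range (j + 1), ((i : ℚ) + 1) • (t (i + 1) * partitionSum t (j - i)) =
      ∑ μ : Nat.Partition (j + 1), (((i : ℚ) + 1) * (μ.parts.count (i + 1) : ℚ)) •
        ((autCard μ : ℚ)⁻¹) • (μ.parts.map t).prod := by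
    intro i hi
    have hi' := Finset.mem_range.1 hi
    rw [show j - i = j + 1 - (i + 1) by omega, ← sum_count_smul t (Nat.succ_pos i) (by omega),
      Finset.smul_sum]
    simp only [smul_smul, mul_assoc]
  rw [Finset.sum_congr rfl h1, Finset.sum_comm, partitionSum, Finset.smul_sum]
  refine Finset.sum_congr rfl fun μ _ => ?_
  rw [← Finset.sum_smul]
  congr 1
  have h2 : (j + 1 : ℕ) = ∑ i ∈ Finset.range (j + 1), (i + 1) * μ.parts.count (i + 1) := by
    conv_lhs => rw [← μ.parts_sum, ← Multiset.map_id μ.parts,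
      Finset.sum_multiset_map_count μ.parts id]
    have hsub : μ.parts.toFinset ⊆ (Finset.range (j + 2)) := by
      intro i hi
      have := Multiset.single_le_sum (fun _ _ => Nat.zero_le _) i (Multiset.mem_toFinset.1 hi)
      rw [μ.parts_sum] at this
      exact Finset.mem_range.2 (by omega)
    rw [Finset.sum_subset hsub, Finset.sum_range_succ']
    · simp [mul_comm]
    · intro i _ hi
      rw [Multiset.count_eq_zero_of_notMem (fun h => hi (Multiset.mem_toFinset.2 h)), zero_smul]
  exact_mod_cast h2

theorem partitionSum_zero {A : Type*} [CommRing A] [Algebra ℚ A] (t : ℕ → A) :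
    partitionSum t 0 = 1 := by
  rw [partitionSum, Fintype.sum_unique]
  simp [autCard]

theorem coeff_zero_sinhProd (n : ℕ) : PowerSeries.coeff 0 (sinhProd n) = 1 := by
  rw [sinhProd, PowerSeries.coeff_zero_eq_constantCoeff_apply, map_prod]
  refine Finset.prod_eq_one fun i _ => ?_
  rw [← PowerSeries.coeff_zero_eq_constantCoeff_apply, PowerSeries.coeff_rescale,
    PowerSeries.coeff_map, PowerSeries.coeff_zero_eq_constantCoeff_apply, constantCoeff_sinhDivX]
  simp

/-- Exponential formula: both sequences start at `1` and satisfy the same recursion. -/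
theorem coeff_sinhProd_eq_partitionSum (n j : ℕ) :
    PowerSeries.coeff (2 * j) (sinhProd n) = partitionSum (fun i =>
      MvPolynomial.C (xi (2 * i)) * MvPolynomial.psum (Fin n) ℚ (2 * i)) j := by
  induction j using Nat.strong_induction_on with
  | _ j ih =>
    cases j with
    | zero => rw [partitionSum_zero, mul_zero, coeff_zero_sinhProd]
    | succ j =>
      have h : ((j : ℚ) + 1) ≠ 0 := by positivity
      refine smul_right_injective _ h ?_
      change ((j : ℚ) + 1) • _ = ((j : ℚ) + 1) • _
      rw [coeff_sinhProd_succ, partitionSum_succ]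
      refine Finset.sum_congr rfl fun i _ => ?_
      rw [ih (j - i) (by omega)]

theorem coeff_sinhProd_eq (n j : ℕ) :
    PowerSeries.coeff (2 * j) (sinhProd n) = ∑ μ : Nat.Partition j,
      MvPolynomial.C (xiPart (double μ) / (autCard μ : ℚ)) *
        MvPolynomial.psumPart (Fin n) ℚ (double μ) := by
  rw [coeff_sinhProd_eq_partitionSum, partitionSum]
  refine Finset.sum_congr rfl fun μ _ => ?_
  rw [Multiset.prod_map_mul, MvPolynomial.smul_eq_C_mul, ← mul_assoc, div_eq_mul_inv, mul_comm
    (xiPart _), map_mul]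
  congr 2
  · rw [xiPart, map_multiset_prod, Multiset.map_map, double, Multiset.map_map]
    rfl
  · rw [double, Multiset.map_map]
    rfl

end ExpFormula

/-! ### The top coefficients -/

section TopCoefficients

variable {n : ℕ}

theorem isHomogeneous_coeff_sinhProd (n m : ℕ) :
    (PowerSeries.coeff m (sinhProd n)).IsHomogeneous m := by
  have h : ∀ s : Finset (Fin n), ∀ m, (PowerSeries.coeff m (∏ i ∈ s,
      PowerSeries.rescale (MvPolynomial.X i : MvPolynomial (Fin n) ℚ)
        (PowerSeries.map MvPolynomial.C sinhDivX))).IsHomogeneous m := by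
    intro s
    induction s using Finset.induction_on with
    | empty =>
      intro m
      rw [Finset.prod_empty, PowerSeries.coeff_one]
      split_ifs with hm
      · rw [hm]; exact MvPolynomial.isHomogeneous_one _ _
      · exact MvPolynomial.isHomogeneous_zero _ _ _
    | insert a s ha ih =>
      intro m
      rw [Finset.prod_insert ha, PowerSeries.coeff_mul]
      refine MvPolynomial.IsHomogeneous.sum _ _ _ fun p hp => ?_
      rw [← Finset.HasAntidiagonal.mem_antidiagonal.1 hp]
      refine MvPolynomial.IsHomogeneous.mul ?_ (ih _)
      rw [PowerSeries.coeff_rescale, PowerSeries.coeff_map, mul_comm]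
      exact MvPolynomial.IsHomogeneous.C_mul (MvPolynomial.isHomogeneous_X_pow _ _) _
  exact h Finset.univ m

theorem isHomogeneous_sum_X_pow (N : ℕ) :
    ((∑ i : Fin n, MvPolynomial.X i : MvPolynomial (Fin n) ℚ) ^ N).IsHomogeneous N := by
  have h : (∑ i : Fin n, MvPolynomial.X i : MvPolynomial (Fin n) ℚ).IsHomogeneous 1 :=
    MvPolynomial.IsHomogeneous.sum _ _ _ fun i _ => MvPolynomial.isHomogeneous_X _ _
  simpa using h.pow N

/-- The coefficient of `x^p` in `sinhProd` is homogeneous of degree `p`, so in degree `N + m` only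
the constant term `1` of `(sinh x / x)⁻¹` is seen. -/
theorem coeff_mul_sinhQuot (b : Fin n →₀ ℕ) (N m : ℕ) (hb : b.degree = N + m) :
    MvPolynomial.coeff b ((∑ i, MvPolynomial.X i) ^ N * PowerSeries.coeff m (sinhQuot n)) =
      MvPolynomial.coeff b
        ((∑ i, MvPolynomial.X i) ^ N * PowerSeries.coeff m (sinhProd n)) := by
  rw [sinhQuot, PowerSeries.coeff_mul, Finset.mul_sum, MvPolynomial.coeff_sum,
    Finset.sum_eq_single (m, 0)]
  · have h0 : PowerSeries.coeff 0 sinhDivX⁻¹ = 1 := by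
      rw [PowerSeries.coeff_zero_eq_constantCoeff_apply, PowerSeries.constantCoeff_inv,
        constantCoeff_sinhDivX, inv_one]
    rw [PowerSeries.coeff_map, h0, map_one, mul_one]
  · rintro ⟨p, q⟩ hpq hne
    rw [Finset.HasAntidiagonal.mem_antidiagonal] at hpq
    dsimp only at hpq ⊢
    rw [PowerSeries.coeff_map, ← mul_assoc, mul_comm, MvPolynomial.coeff_C_mul,
      ((isHomogeneous_sum_X_pow N).mul (isHomogeneous_coeff_sinhProd n p)).coeff_eq_zero, mul_zero]
    rw [hb]
    intro h
    have hp : p = m := by omega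
    exact hne (Prod.ext hp (by dsimp only; omega))
  · intro h
    exact absurd (Finset.HasAntidiagonal.mem_antidiagonal.2 (add_zero _)) h

theorem coeff_sum_X_pow (c : Fin n →₀ ℕ) (N : ℕ) (hc : c.degree = N) :
    MvPolynomial.coeff c ((∑ i, MvPolynomial.X i : MvPolynomial (Fin n) ℚ) ^ N) =
      (Nat.multinomial Finset.univ c : ℚ) := by
  have hmon : ∀ k : Fin n → ℕ, ∏ i, (MvPolynomial.X i : MvPolynomial (Fin n) ℚ) ^ k i =
      MvPolynomial.monomial (Finsupp.equivFunOnFinite.symm k) 1 := by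
    intro k
    rw [MvPolynomial.monomial_eq, map_one, one_mul, Finsupp.prod_fintype _ _ fun i => pow_zero _]
    rfl
  rw [Finset.sum_pow_eq_sum_piAntidiag, MvPolynomial.coeff_sum,
    Finset.sum_eq_single (c : Fin n → ℕ)]
  · rw [← map_natCast (MvPolynomial.C (σ := Fin n) (R := ℚ)), MvPolynomial.coeff_C_mul, hmon,
      MvPolynomial.coeff_monomial, if_pos, mul_one]
    exact Finsupp.equivFunOnFinite.symm_apply_apply c
  · intro k _ hk
    rw [← map_natCast (MvPolynomial.C (σ := Fin n) (R := ℚ)), MvPolynomial.coeff_C_mul, hmon,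
      MvPolynomial.coeff_monomial, if_neg, mul_zero]
    rintro rfl
    exact hk rfl
  · intro h
    refine absurd (Finset.mem_piAntidiag.2 ⟨?_, fun i _ => Finset.mem_univ i⟩) h
    rw [← hc, Finsupp.degree_eq_sum]

theorem coeff_psumPart {k : ℕ} (μ : Nat.Partition k) (a : Fin n →₀ ℕ) :
    MvPolynomial.coeff a (MvPolynomial.psumPart (Fin n) ℚ μ) =
      (Fintype.card {f : Fin (partList μ).length → Fin n //
        ∀ x, ∑ i with f i = x, (partList μ).get i = a x} : ℚ) := by
  have h1 : MvPolynomial.psumPart (Fin n) ℚ μ =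
      ∏ i : Fin (partList μ).length, MvPolynomial.psum (Fin n) ℚ ((partList μ).get i) := by
    rw [MvPolynomial.psumPart, ← partList_coe, Multiset.map_coe, Multiset.prod_coe]
    simp
  rw [h1]
  simp only [MvPolynomial.psum]
  rw [Finset.prod_univ_sum, Fintype.piFinset_univ, MvPolynomial.coeff_sum, Fintype.card_subtype,
    Finset.card_filter, Nat.cast_sum]
  refine Finset.sum_congr rfl fun f _ => ?_
  have h2 : ∏ i, (MvPolynomial.X (f i) : MvPolynomial (Fin n) ℚ) ^ (partList μ).get i =
      MvPolynomial.monomial (∑ i, Finsupp.single (f i) ((partList μ).get i)) 1 := by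
    rw [MvPolynomial.monomial_sum_one]
    exact Finset.prod_congr rfl fun i _ => MvPolynomial.X_pow_eq_monomial
  rw [h2, MvPolynomial.coeff_monomial, Nat.cast_ite, Nat.cast_one, Nat.cast_zero]
  refine if_congr ?_ rfl rfl
  rw [Finsupp.ext_iff]
  refine forall_congr' fun x => ?_
  rw [Finsupp.finsetSum_apply, Finset.sum_filter]
  simp [Finsupp.single_apply]

/-- Expanding the product of power sums counts maps to all `n` indices with prescribed fibre sums.
Parts are positive, so no part is sent to an index with `a x = 0`, and dropping those indices leaves
the count `R`. -/
theorem coeff_psumPart_eq_R {k : ℕ} (μ : Nat.Partition k) (a : Fin n →₀ ℕ) :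
    MvPolynomial.coeff a (MvPolynomial.psumPart (Fin n) ℚ μ) = (R μ (ofVec a) : ℚ) := by
  classical
  have hcount : ∀ x, (Finsupp.toMultiset a).count x = a x := fun x => Finsupp.count_toMultiset a x
  rw [coeff_psumPart, R, ← card_maps_eq (partList μ) (partList (ofVec a)) (partList_pos μ)
    (Finsupp.toMultiset a)]
  · simp only [hcount]
  · simp only [hcount]
    rw [partList_coe, ofVec_parts_eq_filter]
    have h1 : (Finsupp.toMultiset a).dedup = (Finset.univ.filter fun i => a i ≠ 0).val := by
      rw [← Multiset.toFinset_val, Finsupp.toFinset_toMultiset]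
      congr 1
      ext i
      simp
    rw [h1, Finset.filter_val, Multiset.filter_map]
    rfl

theorem coeff_psumPart_double_eq_zero {k : ℕ} (μ : Nat.Partition k) (a : Fin n →₀ ℕ)
    (h : ¬((∀ i, Even (a i)) ∧ ∑ i, a i = 2 * k)) :
    MvPolynomial.coeff a (MvPolynomial.psumPart (Fin n) ℚ (double μ)) = 0 := by
  rw [coeff_psumPart, Nat.cast_eq_zero, Fintype.card_eq_zero_iff]
  refine ⟨fun f => h ⟨fun x => ?_, ?_⟩⟩
  · rw [← f.2 x]
    refine Finset.even_sum _ fun i _ => ?_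
    have hmem : (partList (double μ)).get i ∈ (double μ).parts := by
      rw [← partList_coe]
      exact List.get_mem _ i
    obtain ⟨j, -, hj⟩ := Multiset.mem_map.1 hmem
    rw [← hj]
    exact even_two_mul j
  · rw [← Finset.sum_congr rfl fun x _ => f.2 x, Finset.sum_fiberwise]
    have h1 := (double μ).parts_sum
    rw [← partList_coe, Multiset.sum_coe] at h1
    simpa using h1

theorem coeff_pow_mul_psumPart {k : ℕ} (μ : Nat.Partition k) (b : Fin n → ℕ) (N : ℕ)
    (hb : ∑ i, b i = N + 2 * k) :
    MvPolynomial.coeff (Finsupp.equivFunOnFinite.symm b)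
      ((∑ i, MvPolynomial.X i) ^ N * MvPolynomial.psumPart (Fin n) ℚ (double μ)) =
      ∑ a ∈ D (2 * k) b, (R (double μ) (ofVec a) : ℚ) *
        (Nat.multinomial Finset.univ (fun i => b i - a i) : ℚ) := by
  classical
  rw [mul_comm, MvPolynomial.coeff_mul]
  symm
  have hD : ∀ a, a ∈ D (2 * k) b ↔ (∀ i, a i ≤ b i) ∧ (∀ i, Even (a i)) ∧ ∑ i, a i = 2 * k := by
    intro a
    simp [D]
  refine Finset.sum_of_injOn (fun a => (Finsupp.equivFunOnFinite.symm a,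
    Finsupp.equivFunOnFinite.symm fun i => b i - a i)) ?_ ?_ ?_ ?_
  · intro a _ a' _ h
    exact Finsupp.equivFunOnFinite.symm.injective (congrArg Prod.fst h)
  · intro a ha
    rw [Finset.mem_coe, Finset.HasAntidiagonal.mem_antidiagonal]
    ext i
    have := ((hD a).1 ha).1 i
    simp
    omega
  · rintro ⟨p, q⟩ hpq hne
    rw [Finset.HasAntidiagonal.mem_antidiagonal] at hpq
    dsimp only at hpq ⊢
    have hpq' : ∀ i, p i + q i = b i := fun i => by
      have := DFunLike.congr_fun hpq i
      simpa using this
    -- Every monomial of `P_{2λ}` has even exponents with sum `2k`, so a splitting of `b` outside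
    -- `D` contributes nothing.
    rw [coeff_psumPart_double_eq_zero, zero_mul]
    intro h
    refine hne ⟨p, (hD p).2 ⟨fun i => by have := hpq' i; omega, h⟩, ?_⟩
    refine Prod.ext ?_ ?_
    · ext i; simp
    · ext i
      have := hpq' i
      simp
      omega
  · intro a ha
    obtain ⟨h1, h2, h3⟩ := (hD a).1 ha
    have hdeg : (Finsupp.equivFunOnFinite.symm fun i => b i - a i).degree = N := by
      rw [Finsupp.degree_eq_sum]
      simp only [Finsupp.equivFunOnFinite_symm_apply_apply]
      have h4 : ∑ i, (b i - a i) + ∑ i, a i = ∑ i, b i := by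
        rw [← Finset.sum_add_distrib]
        exact Finset.sum_congr rfl fun i _ => Nat.sub_add_cancel (h1 i)
      omega
    dsimp only
    rw [coeff_sum_X_pow _ N hdeg, coeff_psumPart_eq_R]
    rfl

theorem coeff_explicitPolynomial (g r : ℕ) (b : Fin (2 * r + 1) → ℕ)
    (hb : ∑ i, b i = 3 * g + r) :
    (explicitPolynomial g r).coeff (Finsupp.equivFunOnFinite.symm b) =
      1 / (2 : ℚ) ^ (3 * g + r) *
        ∑ h ∈ Finset.range (g + 1),
          ((2 * (g + r) - 2 * h)! : ℚ) / ((h ! : ℚ) * ((g + r - h)! : ℚ) * 3 ^ h) *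
            ∑ lam : Nat.Partition (g - h), ∑ a ∈ D (2 * g - 2 * h) b,
              xiPart (double lam) * (R (double lam) (ofVec a) : ℚ) / (autCard lam : ℚ) *
                (Nat.multinomial Finset.univ (fun i => b i - a i) : ℚ) := by
  rw [explicitPolynomial, MvPolynomial.coeff_sum, Finset.mul_sum]
  refine Finset.sum_congr rfl fun h hh => ?_
  have hhg : h ≤ g := by have := Finset.mem_range.1 hh; omega
  have e1 : 2 * g - 2 * h = 2 * (g - h) := by omega
  have hdeg : (Finsupp.equivFunOnFinite.symm b).degree = (g + r + 2 * h) + 2 * (g - h) := by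
    rw [Finsupp.degree_eq_sum]
    simp only [Finsupp.equivFunOnFinite_symm_apply_apply]
    omega
  rw [MvPolynomial.coeff_C_mul, e1, coeff_mul_sinhQuot _ _ _ hdeg, coeff_sinhProd_eq,
    Finset.mul_sum, MvPolynomial.coeff_sum]
  have h1 : ∀ lam : Nat.Partition (g - h), MvPolynomial.coeff (Finsupp.equivFunOnFinite.symm b)
      ((∑ i, MvPolynomial.X i) ^ (g + r + 2 * h) *
        (MvPolynomial.C (xiPart (double lam) / (autCard lam : ℚ)) *
          MvPolynomial.psumPart (Fin (2 * r + 1)) ℚ (double lam))) =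
      ∑ a ∈ D (2 * (g - h)) b,
        xiPart (double lam) * (R (double lam) (ofVec a) : ℚ) / (autCard lam : ℚ) *
          (Nat.multinomial Finset.univ (fun i => b i - a i) : ℚ) := by
    intro lam
    rw [mul_left_comm, MvPolynomial.coeff_C_mul,
      coeff_pow_mul_psumPart lam b _ (by omega), Finset.mul_sum]
    exact Finset.sum_congr rfl fun a _ => by ring
  rw [Finset.sum_congr rfl fun lam _ => h1 lam, ← mul_assoc]
  congr 1
  obtain ⟨u, rfl⟩ := Nat.exists_eq_add_of_le hhg
  have e4 : h + u - h = u := by omega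
  have p3 : (4 : ℚ) ^ u = 2 ^ (2 * u) := by rw [pow_mul]; norm_num
  have e5 : 3 * (h + u) + r = (h + u + r + 2 * h) + 2 * u := by ring
  rw [e4, p3, e5, pow_add 2 (h + u + r + 2 * h)]
  simp only [div_eq_mul_inv, mul_inv]
  ring

/-- Existence is the explicit polynomial; uniqueness holds because a polynomial is determined by its
values on a product of infinite sets. -/
theorem existsUnique_isHurwitzPolynomial (g r : ℕ) :
    ∃! P : MvPolynomial (Fin (2 * r + 1)) ℚ, IsHurwitzPolynomial g (2 * r + 1) P := by
  refine ⟨explicitPolynomial g r, isHurwitzPolynomial_explicitPolynomial g r, fun P hP => ?_⟩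
  have hinf : (Set.range fun k : ℕ => ((k + 1 : ℕ) : ℚ)).Infinite :=
    Set.infinite_range_of_injective fun a b h => by
      have := Nat.cast_injective h
      omega
  refine MvPolynomial.funext_set (fun _ => Set.range fun k : ℕ => ((k + 1 : ℕ) : ℚ))
    (fun _ => hinf) fun x hx => ?_
  choose β hβ using fun i => hx i (Set.mem_univ i)
  have hx' : x = fun i => ((β i + 1 : ℕ) : ℚ) := funext fun i => (hβ i).symm
  rw [hx', hP (fun i => β i + 1) fun i => Nat.succ_pos _,
    isHurwitzPolynomial_explicitPolynomial g r (fun i => β i + 1) fun i => Nat.succ_pos _]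

theorem hurwitzPolynomial_eq (g r : ℕ) :
    hurwitzPolynomial g (2 * r + 1) = explicitPolynomial g r := by
  have hex : ∃ P, IsHurwitzPolynomial g (2 * r + 1) P :=
    ⟨_, isHurwitzPolynomial_explicitPolynomial g r⟩
  rw [hurwitzPolynomial, dif_pos hex]
  exact (existsUnique_isHurwitzPolynomial g r).unique hex.choose_spec
    (isHurwitzPolynomial_explicitPolynomial g r)

end TopCoefficients

end HurwitzHodge

end

open HurwitzHodge in
theorem proposition4p4 (g n : ℕ) (hn : Odd n) (b : Fin n → ℕ)
    (hb : ∑ i, b i = 3 * g + (n - 1) / 2) (s : ℕ) (hs : s = g + (n - 1) / 2) :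
    (∃! P : MvPolynomial (Fin n) ℚ, IsHurwitzPolynomial g n P) ∧
    wittenTerm g b =
      1 / (2 : ℚ) ^ (3 * g + (n - 1) / 2) *
        ∑ h ∈ Finset.range (g + 1),
          ((2 * s - 2 * h)! : ℚ) / ((h ! : ℚ) * ((s - h)! : ℚ) * 3 ^ h) *
            ∑ lam : Nat.Partition (g - h), ∑ a ∈ D (2 * g - 2 * h) b,
              xiPart (double lam) * (R (double lam) (ofVec a) : ℚ) / (autCard lam : ℚ) *
                (Nat.multinomial Finset.univ (fun i => b i - a i) : ℚ) := by
  -- Oddness of `n` makes the truncated quotient `(n - 1) / 2` exactly `r`.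
  obtain ⟨r, rfl⟩ := hn
  have hr : (2 * r + 1 - 1) / 2 = r := by omega
  rw [hr] at hb hs ⊢
  subst hs
  refine ⟨existsUnique_isHurwitzPolynomial g r, ?_⟩
  rw [wittenTerm, combHodge, if_pos (by rw [hb, hr]; rfl), pow_zero, one_mul,
    hurwitzPolynomial_eq, coeff_explicitPolynomial g r b hb]
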